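/- Let $(R,m_R)$ be a Noetherian local ring, $M$ a finitely generated $R$-module, $r\ge 1$, and let $\mathcal I(1)=\{I(1)_n\}_{n\ge 0},\ldots,\mathcal I(r)=\{I(r)_n\}_{n\ge 0}$ be Noetherian filtrations of $R$ by $m_R$-primary ideals; that is, for each $j$, $R=I(j)_0\supseteq I(j)_1\supseteq I(j)_2\supseteq\cdots$ are ideals with $I(j)_mI(j)_n\subseteq I(j)_{m+n}$ for all $m,n\ge 0$, the ideal $I(j)_n$ is $m_R$-primary for all $n\ge 1$, and $\bigoplus_{n\ge 0}I(j)_n$ is a finitely generated $R$-algebra. Let $\lambda$ denote length as an $R$-module. A function $\sigma:\mathbb N^r\to\mathbb Q$ (where $0\in\mathbb N$) is called periodic if there is an integer $\alpha\ge 1$ such that $\sigma(n_1,\ldots,n_j+\alpha,\ldots,n_r)=\sigma(n_1,\ldots,n_r)$ for all $(n_1,\ldots,n_r)\in\mathbb N^r$ and all $1\le j\le r$. Then there exist a positive integer $c$ and periodic functions $\sigma_{i_1,\ldots,i_r}:\mathbb N^r\to\mathbb Q$, for $i_1,\ldots,i_r\in\mathbb N$ with $i_1+\cdots+i_r\le\dim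 M$, such that for all $n_1,\ldots,n_r\ge c$ the length $\lambda(M/I(1)_{n_1}\cdots I(r)_{n_r}M)$ is finite and $$ \lambda(M/I(1)_{n_1}\cdots I(r)_{n_r}M)=\sum_{i_1+\cdots+i_r\le\dim M}\sigma_{i_1,\ldots,i_r}(n_1,\ldots,n_r)\,n_1^{i_1}\cdots n_r^{i_r}. $$ Moreover, this quasi-polynomial has total degree equal to $\dim M$: the largest value of $i_1+\cdots+i_r$ for which $\sigma_{i_1,\ldots,i_r}$ is not identically zero is $\dim M$. Finally, $\sigma_{i_1,\ldots,i_r}$ is a constant function whenever $i_1+\cdots+i_r=\dim M$. (If $M=0$, both $\dim M$ and the total degree of the zero quasi-polynomial are $-\infty$, and the sum is empty.) -/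

import Mathlib

open Polynomial

universe u v

/-- A filtration of ideals `R = I₀ ⊇ I₁ ⊇ I₂ ⊇ ⋯` on a ring `R`, with `Iᵢ Iⱼ ⊆ Iᵢ₊ⱼ`. -/
structure IdealFiltration (R : Type u) [CommRing R] where
  /-- the `n`-th ideal of the filtration -/
  ideal : ℕ → Ideal R
  ideal_zero : ideal 0 = ⊤
  antitone : Antitone ideal
  mul_le : ∀ i j : ℕ, ideal i * ideal j ≤ ideal (i + j)

namespace IdealFiltration

variable {R : Type u} [CommRing R]

/-- The graded `R`-algebra `⨁ₙ Iₙ`, realised as the subalgebra `⨁ₙ Iₙ Xⁿ` of `R[X]`: the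
polynomials whose coefficient of `Xⁿ` lies in `Iₙ` for every `n`. -/
def reesAlgebra (I : IdealFiltration R) : Subalgebra R R[X] where
  carrier := {f | ∀ n : ℕ, f.coeff n ∈ I.ideal n}
  mul_mem' := by
    intro f g hf hg n
    rw [Polynomial.coeff_mul]
    refine Ideal.sum_mem _ fun p hp => ?_
    rw [← Finset.HasAntidiagonal.mem_antidiagonal.mp hp]
    exact I.mul_le _ _ (Ideal.mul_mem_mul (hf p.1) (hg p.2))
  add_mem' := by
    intro f g hf hg n
    rw [Polynomial.coeff_add]
    exact Ideal.add_mem _ (hf n) (hg n)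
  algebraMap_mem' := by
    intro a n
    rw [Polynomial.algebraMap_apply, Polynomial.coeff_C]
    split_ifs with h
    · rw [h, I.ideal_zero]
      exact Submodule.mem_top
    · exact Ideal.zero_mem _

/-- The filtration is Noetherian: `⨁ₙ Iₙ` is a finitely generated `R`-algebra. -/
def IsNoetherian (I : IdealFiltration R) : Prop :=
  Algebra.FiniteType R I.reesAlgebra

/-- A filtration of the local ring `R` by `m_R`-primary ideals: `Iₙ` is `m_R`-primary for
all `n ≥ 1`. -/
def IsMaximalPrimary [IsLocalRing R] (I : IdealFiltration R) : Prop :=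
  ∀ n : ℕ, 1 ≤ n →
    (I.ideal n).IsPrimary ∧ (I.ideal n).radical = IsLocalRing.maximalIdeal R

end IdealFiltration

/-- A map `σ : ℕʳ → ℚ` is periodic if some positive integer `α` is a period of `σ` in each
variable. -/
def IsMultiPeriodic {r : ℕ} (σ : (Fin r → ℕ) → ℚ) : Prop :=
  ∃ α : ℕ, 0 < α ∧ ∀ (n : Fin r → ℕ) (j : Fin r), σ (n + Pi.single j α) = σ n

/-- A quasi-polynomial in `r` variables: a finite formal sum
`∑ σ_{i₁,…,iᵣ}(n₁,…,nᵣ) n₁^{i₁} ⋯ nᵣ^{iᵣ}` whose coefficients `σ_{i₁,…,iᵣ} : ℕʳ → ℚ` are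
periodic functions. -/
structure QuasiPolynomial (r : ℕ) where
  /-- the coefficient function `σ_{i₁,…,iᵣ}` of each exponent `(i₁,…,iᵣ)` -/
  coeff : (Fin r →₀ ℕ) →₀ ((Fin r → ℕ) → ℚ)
  periodic : ∀ i : Fin r →₀ ℕ, IsMultiPeriodic (coeff i)

namespace QuasiPolynomial

variable {r : ℕ}

/-- The value `∑ σ_{i₁,…,iᵣ}(n₁,…,nᵣ) n₁^{i₁} ⋯ nᵣ^{iᵣ}` at `(n₁,…,nᵣ)`. -/
noncomputable def eval (P : QuasiPolynomial r) (n : Fin r → ℕ) : ℚ :=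
  ∑ i ∈ P.coeff.support, P.coeff i n * ∏ j : Fin r, (n j : ℚ) ^ i j

/-- The total degree: the largest `i₁ + ⋯ + iᵣ` for which `σ_{i₁,…,iᵣ}` is not identically
zero (and `⊥`, that is `-∞`, if there is none). -/
noncomputable def totalDegree (P : QuasiPolynomial r) : WithBot ℕ∞ :=
  P.coeff.support.sup fun i => ((∑ j : Fin r, i j : ℕ) : WithBot ℕ∞)

end QuasiPolynomial

/-! A Noetherian filtration is eventually multiplicatively periodic: `I (n + α) = I α * I n` for
large `n`, and one `α` serves all the filtrations (`exists_common_isPeriodFrom`). Fix exponents `b`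
past the threshold and put `K = ∏ I(j)_{b_j} M`. Then λ at `b + α t` equals `λ(M/K)` plus `λ(K / ∏
I(j)_α ^ t_j K)`, so everything reduces to powers of finitely many ideals.

For such powers, the difference in the direction `t_j` is the length of a graded piece of a finitely
generated multigraded module over a polynomial ring. As in the Hilbert–Serre theorem, multiplication
by a variable gives a four-term exact sequence whose kernel and cokernel are killed by one more
variable (`isEventuallyPolynomial_relLength`). This yields one polynomial per residue class modulo
`α`, that is, a quasi-polynomial.

For the degree, let `J = ∏ I(j)_α` and `d = dim M`. On the diagonal the length is compared with the
function `t ↦ λ(M/J^t M)`, which is at most a constant times `(t + 1)^d` (dévissage to `R/p`) and,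
along an arithmetic progression, at least `t.choose d` (chains of primes and Artin–Rees). The degree
`d` form of each polynomial at `α m` is the limit of values along `u + s α m`, divided by `s^d`; it
does not depend on `u`. Since the length is monotone in the exponents, every class is squeezed
between two representatives of the class 0. Hence all classes share one degree `d` form, and the
lower bound makes it nonzero. -/

/-! ### Eventual periodicity of Noetherian filtrations -/

namespace IdealFiltration

variable {R : Type u} [CommRing R]

lemma prod_pow_le (I : IdealFiltration R) (s : Finset ℕ) (m : ℕ → ℕ) :
    ∏ d ∈ s, I.ideal d ^ m d ≤ I.ideal (∑ d ∈ s, d * m d) := by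
  classical
  have hpow : ∀ d k, I.ideal d ^ k ≤ I.ideal (d * k) := by
    intro d k
    induction k with
    | zero => simp [I.ideal_zero]
    | succ k ih =>
      rw [pow_succ, Nat.mul_succ]
      exact (Ideal.mul_mono_left ih).trans (I.mul_le _ _)
  induction s using Finset.induction_on with
  | empty => simp [I.ideal_zero]
  | insert a s ha ih =>
    rw [Finset.prod_insert ha, Finset.sum_insert ha]
    exact (Ideal.mul_mono (hpow _ _) ih).trans (I.mul_le _ _)

/-- The part of degree `n` of the subalgebra of `⨁ₙ Iₙ` generated in degrees at most `D`. -/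
def generatedIdeal (I : IdealFiltration R) (D n : ℕ) : Ideal R :=
  ⨆ m : {m : ℕ → ℕ // ∑ d ∈ Finset.Icc 1 D, d * m d = n},
    ∏ d ∈ Finset.Icc 1 D, I.ideal d ^ m.1 d

lemma generatedIdeal_mul_le (I : IdealFiltration R) (D i j : ℕ) :
    I.generatedIdeal D i * I.generatedIdeal D j ≤ I.generatedIdeal D (i + j) := by
  unfold generatedIdeal
  rw [Ideal.iSup_mul]
  refine iSup_le fun m => ?_
  rw [Ideal.mul_iSup]
  refine iSup_le fun m' => ?_
  rw [← Finset.prod_mul_distrib]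
  simp_rw [← pow_add]
  refine le_iSup_of_le ⟨m.1 + m'.1, ?_⟩ le_rfl
  simp only [Pi.add_apply, mul_add, Finset.sum_add_distrib, m.2, m'.2]

lemma le_generatedIdeal (I : IdealFiltration R) {D n : ℕ} (hn : n ≤ D) :
    I.ideal n ≤ I.generatedIdeal D n := by
  classical
  rcases Nat.eq_zero_or_pos n with rfl | hpos
  · refine le_iSup_of_le ⟨0, by simp⟩ ?_
    simp only [Pi.zero_apply, pow_zero, Finset.prod_const_one]
    exact Ideal.one_eq_top (R := R) ▸ le_top
  · refine le_iSup_of_le ⟨Pi.single n 1, ?_⟩ ?_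
    · rw [Finset.sum_eq_single_of_mem n (by simp; omega)]
      · simp
      · intro b _ hb; simp [hb]
    · rw [Finset.prod_eq_single_of_mem n (by simp; omega)]
      · simp
      · intro b _ hb; simp [hb]

/-- The polynomials with coefficients in the `generatedIdeal D n` form a subalgebra; with `D` the
largest degree of a finite set of generators, it contains these generators, hence the whole Rees
algebra. -/
lemma ideal_le_generatedIdeal (I : IdealFiltration R) (h : I.IsNoetherian) :
    ∃ D, ∀ n, I.ideal n ≤ I.generatedIdeal D n := by
  obtain ⟨s, hs⟩ := (Subalgebra.fg_iff_finiteType _).mpr h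
  refine ⟨s.sup natDegree, fun n a ha => ?_⟩
  set D := s.sup natDegree
  let S : Subalgebra R R[X] :=
    { carrier := {f | ∀ n, f.coeff n ∈ I.generatedIdeal D n}
      mul_mem' := by
        intro f g hf hg n
        rw [Polynomial.coeff_mul]
        refine Ideal.sum_mem _ fun p hp => ?_
        rw [← Finset.HasAntidiagonal.mem_antidiagonal.mp hp]
        exact I.generatedIdeal_mul_le _ _ _ (Ideal.mul_mem_mul (hf p.1) (hg p.2))
      add_mem' := by
        intro f g hf hg n
        rw [Polynomial.coeff_add]
        exact Ideal.add_mem _ (hf n) (hg n)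
      algebraMap_mem' := by
        intro a n
        rw [Polynomial.algebraMap_apply, Polynomial.coeff_C]
        split_ifs with h
        · subst h
          refine I.le_generatedIdeal (Nat.zero_le _) ?_
          rw [I.ideal_zero]; trivial
        · exact Ideal.zero_mem _ }
  have hle : I.reesAlgebra ≤ S := by
    rw [← hs, Algebra.adjoin_le_iff]
    intro f hf k
    by_cases hk : k ≤ D
    · refine I.le_generatedIdeal hk ?_
      have : f ∈ I.reesAlgebra := hs ▸ Algebra.subset_adjoin hf
      exact this k
    · rw [coeff_eq_zero_of_natDegree_lt]
      · exact Ideal.zero_mem _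
      · exact lt_of_le_of_lt (Finset.le_sup (f := natDegree) hf) (not_le.mp hk)
  have hmem : monomial n a ∈ I.reesAlgebra := by
    intro k
    rw [coeff_monomial]
    split_ifs with h
    · exact h ▸ ha
    · exact Ideal.zero_mem _
  simpa using hle hmem n

/-- `α` is a period of the filtration from `c` on: `Iₙ₊α = Iα Iₙ` for `n ≥ c`. -/
def IsPeriodFrom (I : IdealFiltration R) (α c : ℕ) : Prop :=
  ∀ n, c ≤ n → I.ideal (n + α) = I.ideal α * I.ideal n

/-- Pigeonhole with `α = D!`: a product of total weight `n + α > D α` in degrees `1, …, D` has some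
degree `d` contributing at least `α`. As `d ∣ α`, a factor of weight exactly `α` splits off, and the
rest has weight `n`. -/
lemma IsNoetherian.exists_isPeriodFrom {I : IdealFiltration R} (h : I.IsNoetherian) :
    ∃ α c, 0 < α ∧ I.IsPeriodFrom α c := by
  classical
  obtain ⟨D, hD⟩ := I.ideal_le_generatedIdeal h
  set α := D.factorial with hα
  have hαpos : 0 < α := Nat.factorial_pos D
  refine ⟨α, D * α, hαpos, fun n hn => le_antisymm ?_ ?_⟩
  · refine (hD _).trans (iSup_le fun ⟨m, hm⟩ => ?_)
    obtain ⟨d, hd, hdα⟩ : ∃ d ∈ Finset.Icc 1 D, α ≤ d * m d := by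
      by_contra! hcon
      have h1 : ∑ d ∈ Finset.Icc 1 D, d * m d ≤ ∑ d ∈ Finset.Icc 1 D, α :=
        Finset.sum_le_sum fun d hd => (hcon d hd).le
      simp only [Finset.sum_const, Nat.card_Icc, smul_eq_mul, Nat.add_sub_cancel] at h1
      omega
    have hdD := Finset.mem_Icc.mp hd
    obtain ⟨k, hk⟩ : d ∣ α := Nat.dvd_factorial hdD.1 hdD.2
    have hkm : k ≤ m d := by
      rw [hk] at hdα
      exact Nat.le_of_mul_le_mul_left hdα hdD.1
    -- Remove `k = α / d` factors from degree `d`; their product lies in `I α`.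
    obtain ⟨m', rfl⟩ : ∃ m' : ℕ → ℕ, m = (Pi.single d k : ℕ → ℕ) + m' := by
      refine ⟨Function.update m d (m d - k), funext fun e => ?_⟩
      change m e = Pi.single (M := fun _ => ℕ) d k e + Function.update m d (m d - k) e
      by_cases he : e = d
      · subst he
        rw [Pi.single_eq_same, Function.update_self]
        omega
      · rw [Pi.single_eq_of_ne he, Function.update_of_ne he, zero_add]
    have hsum : ∑ e ∈ Finset.Icc 1 D, e * (Pi.single d k : ℕ → ℕ) e = α := by
      rw [Finset.sum_eq_single_of_mem d hd]
      · simp [hk]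
      · intro b _ hb; simp [hb]
    have hsum' : ∑ e ∈ Finset.Icc 1 D, e * m' e = n := by
      simp only [Pi.add_apply, mul_add, Finset.sum_add_distrib, hsum] at hm
      omega
    simp only [Pi.add_apply, pow_add, Finset.prod_mul_distrib]
    refine Ideal.mul_mono ?_ ?_
    · exact (I.prod_pow_le _ _).trans (by rw [hsum])
    · exact (I.prod_pow_le _ _).trans (by rw [hsum'])
  · rw [add_comm]
    exact I.mul_le _ _

lemma IsPeriodFrom.ideal_add_mul {I : IdealFiltration R} {α c : ℕ} (h : I.IsPeriodFrom α c)
    {n : ℕ} (hn : c ≤ n) (t : ℕ) : I.ideal (n + α * t) = I.ideal α ^ t * I.ideal n := by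
  induction t with
  | zero => simp
  | succ t ih =>
    rw [Nat.mul_succ, ← add_assoc, h _ (by omega), ih, pow_succ', mul_assoc]

lemma IsPeriodFrom.mul {I : IdealFiltration R} {α c : ℕ} (h : I.IsPeriodFrom α c)
    (k : ℕ) : I.IsPeriodFrom (α * k) c := by
  intro n hn
  refine le_antisymm ?_ ?_
  · rw [h.ideal_add_mul hn]
    refine Ideal.mul_mono_left ?_
    simpa using I.prod_pow_le {α} (fun _ => k)
  · rw [add_comm]
    exact I.mul_le _ _

lemma IsPeriodFrom.mono {I : IdealFiltration R} {α c c' : ℕ} (h : I.IsPeriodFrom α c)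
    (hc : c ≤ c') : I.IsPeriodFrom α c' := fun n hn => h n (hc.trans hn)

lemma exists_common_isPeriodFrom {r : ℕ} (I : Fin r → IdealFiltration R)
    (h : ∀ j, (I j).IsNoetherian) : ∃ α c, 0 < α ∧ ∀ j, (I j).IsPeriodFrom α c := by
  choose α c hα hc using fun j => (h j).exists_isPeriodFrom
  refine ⟨∏ j, α j, ∑ j, c j, Finset.prod_pos fun j _ => hα j, fun j => ?_⟩
  rw [← Finset.mul_prod_erase _ _ (Finset.mem_univ j)]
  exact ((hc j).mul _).mono (Finset.single_le_sum (fun _ _ => Nat.zero_le _) (Finset.mem_univ j))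

end IdealFiltration

/-! ### Upper and lower bounds for the Hilbert–Samuel function -/

section HilbertSamuel

open scoped Pointwise

variable {R : Type*} [CommRing R]
variable {M : Type*} [AddCommGroup M] [Module R M]
variable {N : Type*} [AddCommGroup N] [Module R N]
variable {P : Type*} [AddCommGroup P] [Module R P]

/-- The Hilbert–Samuel function `t ↦ λ(M / Jᵗ M)`. -/
noncomputable def hilbertSamuel (J : Ideal R) (M : Type*) [AddCommGroup M] [Module R M] (t : ℕ) :
    ℕ∞ :=
  Module.length R (M ⧸ (J ^ t • ⊤ : Submodule R M))

lemma length_quotient_le_of_le {A B : Submodule R M} (h : A ≤ B) :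
    Module.length R (M ⧸ B) ≤ Module.length R (M ⧸ A) :=
  Module.length_le_of_surjective (Submodule.factor h) (Submodule.factor_surjective h)

lemma smul_top_le_comap (L : Ideal R) (f : N →ₗ[R] M) :
    (L • ⊤ : Submodule R N) ≤ (L • ⊤ : Submodule R M).comap f := by
  rw [← Submodule.map_le_iff_le_comap, Submodule.map_smul'']
  exact Submodule.smul_mono le_rfl le_top

/-- Tensoring with `R ⧸ L` is only right exact; replacing `L N` by the preimage of `L M` restores
exactness on the left. Both the upper and the lower bounds come from estimating this preimage. -/
lemma length_quotient_smul_top_eq_add (L : Ideal R) (f : N →ₗ[R] M) (g : M →ₗ[R] P)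
    (hg : Function.Surjective g) (hfg : Function.Exact f g) :
    Module.length R (M ⧸ (L • ⊤ : Submodule R M)) =
      Module.length R (N ⧸ (L • ⊤ : Submodule R M).comap f) +
        Module.length R (P ⧸ (L • ⊤ : Submodule R P)) := by
  refine Module.length_eq_add_of_exact
    (Submodule.mapQ _ _ f le_rfl) (Submodule.mapQ _ _ g (smul_top_le_comap L g)) ?_ ?_ ?_
  · rw [← LinearMap.ker_eq_bot, Submodule.mapQ, Submodule.ker_liftQ_eq_bot']
    rw [LinearMap.ker_comp, Submodule.ker_mkQ]
  · rintro ⟨p⟩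
    obtain ⟨m, rfl⟩ := hg p
    exact ⟨Submodule.Quotient.mk m, rfl⟩
  · rintro ⟨m⟩
    constructor
    · intro h
      have h1 : g m ∈ (L • ⊤ : Submodule R P) := (Submodule.Quotient.mk_eq_zero _).mp h
      rw [← LinearMap.range_eq_top.mpr hg, LinearMap.range_eq_map, ← Submodule.map_smul''] at h1
      obtain ⟨m', hm', hgm⟩ := h1
      obtain ⟨n, hn⟩ := (hfg (m - m')).mp (by rw [map_sub, hgm, sub_self])
      refine ⟨Submodule.Quotient.mk n, ?_⟩
      refine (Submodule.Quotient.eq _).mpr ?_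
      rw [hn, sub_sub_cancel_left]
      exact neg_mem hm'
    · rintro ⟨⟨n⟩, hn⟩
      rw [← hn]
      refine (Submodule.Quotient.mk_eq_zero _).mpr ?_
      rw [hfg.apply_apply_eq_zero]
      exact zero_mem _

lemma hilbertSamuel_mono (J : Ideal R) {s t : ℕ} (h : s ≤ t) :
    hilbertSamuel J M s ≤ hilbertSamuel J M t :=
  length_quotient_le_of_le (Submodule.smul_mono_left (Ideal.pow_le_pow_right h))

lemma hilbertSamuel_zero (J : Ideal R) : hilbertSamuel J M 0 = 0 := by
  rw [hilbertSamuel, Module.length_eq_zero_iff, Submodule.Quotient.subsingleton_iff]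
  simp

lemma hilbertSamuel_le_of_surjective (J : Ideal R) (g : M →ₗ[R] P) (hg : Function.Surjective g)
    (t : ℕ) : hilbertSamuel J P t ≤ hilbertSamuel J M t := by
  unfold hilbertSamuel
  rw [length_quotient_smul_top_eq_add (J ^ t) (LinearMap.ker g).subtype g hg
    (LinearMap.exact_subtype_ker_map g)]
  exact le_add_self

lemma hilbertSamuel_le_add (J : Ideal R) (f : N →ₗ[R] M) (g : M →ₗ[R] P)
    (hg : Function.Surjective g) (hfg : Function.Exact f g) (t : ℕ) :
    hilbertSamuel J M t ≤ hilbertSamuel J N t + hilbertSamuel J P t := by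
  unfold hilbertSamuel
  rw [length_quotient_smul_top_eq_add (J ^ t) f g hg hfg]
  gcongr
  exact length_quotient_le_of_le (smul_top_le_comap _ f)

/-- Artin–Rees for the image of `f`. -/
lemma exists_comap_pow_smul_top_le [IsNoetherianRing R] [Module.Finite R M] (J : Ideal R)
    (f : N →ₗ[R] M) (hf : Function.Injective f) :
    ∃ k, ∀ t, (J ^ (t + k) • ⊤ : Submodule R M).comap f ≤ (J ^ t • ⊤ : Submodule R N) := by
  obtain ⟨k, hk⟩ := J.exists_pow_inf_eq_pow_smul (LinearMap.range f)
  refine ⟨k, fun t x hx => ?_⟩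
  have h1 : f x ∈ (J ^ (t + k) • ⊤ : Submodule R M) ⊓ LinearMap.range f := ⟨hx, x, rfl⟩
  rw [hk _ (by omega), Nat.add_sub_cancel] at h1
  have h2 : f x ∈ (J ^ t • (⊤ : Submodule R N)).map f := by
    rw [Submodule.map_smul'', ← LinearMap.range_eq_map]
    exact Submodule.smul_mono le_rfl inf_le_right h1
  obtain ⟨y, hy, hyx⟩ := h2
  rwa [← hf hyx]

lemma exists_hilbertSamuel_add_le [IsNoetherianRing R] [Module.Finite R M] (J : Ideal R)
    (f : N →ₗ[R] M) (hf : Function.Injective f) (g : M →ₗ[R] P)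
    (hg : Function.Surjective g) (hfg : Function.Exact f g) :
    ∃ k, ∀ t, hilbertSamuel J N t + hilbertSamuel J P (t + k) ≤ hilbertSamuel J M (t + k) := by
  obtain ⟨k, hk⟩ := exists_comap_pow_smul_top_le J f hf
  refine ⟨k, fun t => ?_⟩
  unfold hilbertSamuel
  rw [length_quotient_smul_top_eq_add (J ^ (t + k)) f g hg hfg]
  gcongr
  exact length_quotient_le_of_le (hk t)

lemma exact_lsmul_mkQ (x : R) :
    Function.Exact (LinearMap.lsmul R M x) (x • ⊤ : Submodule R M).mkQ := by
  intro m
  rw [Submodule.mkQ_apply, Submodule.Quotient.mk_eq_zero, Submodule.mem_smul_pointwise_iff_exists]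
  simp

/-- In the sequence `M → M → M/xM` given by multiplication by `x ∈ J`, the preimage of `J^(t+1) M`
contains `J^t M`. -/
lemma hilbertSamuel_succ_le (J : Ideal R) {x : R} (hx : x ∈ J) (t : ℕ) :
    hilbertSamuel J M (t + 1) ≤
      hilbertSamuel J M t + hilbertSamuel J (QuotSMulTop x M) (t + 1) := by
  unfold hilbertSamuel
  rw [length_quotient_smul_top_eq_add (J ^ (t + 1)) (LinearMap.lsmul R M x)
    (x • ⊤ : Submodule R M).mkQ (Submodule.mkQ_surjective _) (exact_lsmul_mkQ x)]
  gcongr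
  refine length_quotient_le_of_le ?_
  rw [← Submodule.map_le_iff_le_comap]
  rintro _ ⟨m, hm, rfl⟩
  rw [pow_succ', mul_smul]
  exact Submodule.smul_mem_smul hx hm

lemma isSMulRegular_quotient_of_notMem {p : Ideal R} [p.IsPrime] {x : R} (hx : x ∉ p) :
    IsSMulRegular (R ⧸ p) x := by
  rw [isSMulRegular_iff_right_eq_zero_of_smul]
  intro y hy
  obtain ⟨y, rfl⟩ := Submodule.Quotient.mk_surjective _ y
  rw [← Submodule.Quotient.mk_smul, Submodule.Quotient.mk_eq_zero] at hy
  exact (Submodule.Quotient.mk_eq_zero _).mpr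
    ((Ideal.IsPrime.mem_or_mem ‹p.IsPrime› hy).resolve_left hx)

section Local

variable [IsLocalRing R] [IsNoetherianRing R]

open IsLocalRing

/-- If `p` is maximal, the module has length one. Otherwise a regular element of `J` lowers the
dimension by one, and the bound for the quotient is summed over `t`. The equation `d = d' + 1` in
`ih` makes the hypothesis vacuous for `d = 0`. -/
lemma exists_hilbertSamuel_le_of_quotient_prime {J : Ideal R} (hJ : J.radical = maximalIdeal R)
    {d : ℕ} {M : Type v} [AddCommGroup M] [Module R M] [Module.Finite R M]
    (hd : Module.supportDim R M ≤ d) (p : PrimeSpectrum R) (e : M ≃ₗ[R] R ⧸ p.asIdeal)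
    (ih : ∀ d', d = d' + 1 → ∀ (P : Type v) [AddCommGroup P] [Module R P] [Module.Finite R P],
      Module.supportDim R P ≤ d' →
        ∃ b : ℕ, ∀ t, hilbertSamuel J P t ≤ (b * (t + 1) ^ d' : ℕ)) :
    ∃ b : ℕ, ∀ t, hilbertSamuel J M t ≤ (b * (t + 1) ^ d : ℕ) := by
  by_cases hp : p.asIdeal = maximalIdeal R
  · refine ⟨1, fun t => ?_⟩
    have hsimple : IsSimpleModule R (R ⧸ p.asIdeal) := by
      rw [isSimpleModule_iff_isCoatom, hp]
      exact (maximalIdeal.isMaximal R).out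
    calc hilbertSamuel J M t ≤ Module.length R M :=
          Module.length_le_of_surjective (Submodule.mkQ _) (Submodule.mkQ_surjective _)
      _ = 1 := by rw [e.length_eq, Module.length_eq_one]
      _ ≤ _ := by
        rw [one_mul]
        exact_mod_cast Nat.one_le_pow _ _ (Nat.succ_pos t)
  · obtain ⟨x, hxm, hxp⟩ := SetLike.exists_of_lt (lt_of_le_of_ne (le_maximalIdeal p.isPrime.ne_top) hp)
    -- A power of `x` is needed because `x` itself need not lie in `J`.
    obtain ⟨n, hn⟩ : x ∈ J.radical := hJ ▸ hxm
    have hym : x ^ n ∈ maximalIdeal R := hJ ▸ Ideal.le_radical hn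
    have hyp : x ^ n ∉ p.asIdeal := fun h => hxp (p.isPrime.mem_of_pow_mem _ h)
    have hreg : IsSMulRegular M (x ^ n) := by
      rw [e.isSMulRegular_congr]
      exact isSMulRegular_quotient_of_notMem hyp
    have hM : Nontrivial M := by
      have : Nontrivial (R ⧸ p.asIdeal) := Ideal.Quotient.nontrivial_iff.mpr p.isPrime.ne_top
      exact e.toEquiv.nontrivial
    have hdim := Module.supportDim_quotSMulTop_succ_eq_supportDim hreg hym
    have hQ : Nontrivial (QuotSMulTop (x ^ n) M) :=
      nontrivial_quotSMulTop_of_mem_maximalIdeal M hym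
    -- The quotient is nonzero by Nakayama, so its dimension is not `⊥`; this forces `d ≥ 1`.
    obtain ⟨d', rfl, hd'⟩ : ∃ d', d = d' + 1 ∧ Module.supportDim R (QuotSMulTop (x ^ n) M) ≤ d' := by
      obtain ⟨s, hs⟩ := WithBot.ne_bot_iff_exists.mp
        (Module.supportDim_ne_bot_of_nontrivial R (QuotSMulTop (x ^ n) M))
      rw [← hdim, ← hs] at hd
      rw [← hs]
      have hd2 : s + 1 ≤ (d : ℕ∞) := by exact_mod_cast hd
      lift s to ℕ using ne_top_of_le_ne_top (ENat.natCast_ne_top d) (le_self_add.trans hd2)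
      have hd3 : s + 1 ≤ d := by exact_mod_cast hd2
      have hd4 : (s : ℕ∞) ≤ ((d - 1 : ℕ) : ℕ∞) := by exact_mod_cast (by omega : s ≤ d - 1)
      exact ⟨d - 1, by omega, WithBot.coe_le_coe.mpr hd4⟩
    obtain ⟨b, hb⟩ := ih d' rfl _ hd'
    have key : ∀ t, hilbertSamuel J M t ≤ (b * t * (t + 1) ^ d' : ℕ) := by
      intro t
      induction t with
      | zero => simp [hilbertSamuel_zero]
      | succ t iht =>
        refine (hilbertSamuel_succ_le J hn t).trans ((add_le_add iht (hb _)).trans ?_)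
        norm_cast
        calc b * t * (t + 1) ^ d' + b * (t + 1 + 1) ^ d'
            ≤ b * t * (t + 1 + 1) ^ d' + b * (t + 1 + 1) ^ d' := by gcongr; omega
          _ = b * (t + 1) * (t + 1 + 1) ^ d' := by ring
    refine ⟨b, fun t => (key t).trans ?_⟩
    norm_cast
    rw [pow_succ', mul_assoc]
    gcongr
    omega

/-- Dévissage: bounds add along short exact sequences and dimension does not grow on submodules and
quotients, which leaves the modules `R ⧸ p`. -/
lemma exists_hilbertSamuel_le {J : Ideal R} (hJ : J.radical = maximalIdeal R) (d : ℕ)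
    (M : Type v) [AddCommGroup M] [Module R M] [hM : Module.Finite R M]
    (hd : Module.supportDim R M ≤ d) :
    ∃ b : ℕ, ∀ t, hilbertSamuel J M t ≤ (b * (t + 1) ^ d : ℕ) := by
  induction d using Nat.strong_induction_on generalizing M with
  | _ d ihd =>
    induction hM using IsNoetherianRing.induction_on_isQuotientEquivQuotientPrime R with
    | subsingleton N =>
      refine ⟨0, fun t => ?_⟩
      rw [hilbertSamuel, Module.length_eq_zero]
      exact zero_le
    | quotient N p e =>
      exact exists_hilbertSamuel_le_of_quotient_prime hJ hd p e
        fun d' hd' P _ _ _ hP => ihd d' (by omega) P hP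
    | exact N₁ N₂ N₃ f g hf hg hfg ih₁ ih₃ =>
      obtain ⟨b₁, h₁⟩ := ih₁ ((Module.supportDim_le_of_injective f hf).trans hd)
      obtain ⟨b₃, h₃⟩ := ih₃ ((Module.supportDim_le_of_surjective g hg).trans hd)
      refine ⟨b₁ + b₃, fun t => (hilbertSamuel_le_add J f g hg hfg t).trans ?_⟩
      rw [add_mul, Nat.cast_add]
      exact add_le_add (h₁ t) (h₃ t)

/-- Take `q > p` of coheight `d` and `x ∈ q \ p`. Multiplication by `x` is injective on `R ⧸ p` with
cokernel mapping onto `R ⧸ q`, so by Artin–Rees the function of `R ⧸ p` grows by at least that of `R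
⧸ q` at each step of length `k`. Binomial coefficients turn this summation into Pascal's rule. -/
lemma exists_choose_le_hilbertSamuel {J : Ideal R} (hJ : J ≤ maximalIdeal R) (d : ℕ)
    (p : PrimeSpectrum R) (hp : d ≤ Order.coheight p) :
    ∃ a K : ℕ, ∀ t : ℕ, (t.choose d : ℕ∞) ≤ hilbertSamuel J (R ⧸ p.asIdeal) (a + K * t) := by
  induction d generalizing p with
  | zero =>
    refine ⟨1, 0, fun t => ?_⟩
    simp only [Nat.choose_zero_right, zero_mul, add_zero, Nat.cast_one]
    rw [Order.one_le_iff_pos, hilbertSamuel, Module.length_pos_iff, Submodule.Quotient.nontrivial_iff, pow_one]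
    have : Nontrivial (R ⧸ p.asIdeal) := Ideal.Quotient.nontrivial_iff.mpr p.isPrime.ne_top
    refine (Submodule.top_ne_ideal_smul_of_le_jacobson_annihilator ?_).symm
    exact hJ.trans (maximalIdeal_le_jacobson _)
  | succ d ih =>
    have hfin : Order.coheight p < ⊤ := Order.coheight_lt_top p
    obtain ⟨q, hpq, hq⟩ := (Order.coe_lt_coheight_iff (n := d) hfin).mp
      (lt_of_lt_of_le (by exact_mod_cast Nat.lt_succ_self d) hp)
    obtain ⟨a, K, h⟩ := ih q hq.ge
    have hle : p.asIdeal ≤ q.asIdeal := hpq.le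
    obtain ⟨x, hxq, hxp⟩ := SetLike.exists_of_lt (show p.asIdeal < q.asIdeal from hpq)
    have hinj : Function.Injective (LinearMap.lsmul R (R ⧸ p.asIdeal) x) :=
      isSMulRegular_quotient_of_notMem hxp
    obtain ⟨k, hk⟩ := exists_hilbertSamuel_add_le J _ hinj _
      (Submodule.mkQ_surjective _) (exact_lsmul_mkQ x)
    have hsurj : ∀ t, hilbertSamuel J (R ⧸ q.asIdeal) t ≤
        hilbertSamuel J (QuotSMulTop x (R ⧸ p.asIdeal)) t := by
      refine hilbertSamuel_le_of_surjective J
        (Submodule.liftQ _ (Submodule.factor hle) ?_) ?_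
      · intro y hy
        obtain ⟨y, -, rfl⟩ := (Submodule.mem_smul_pointwise_iff_exists _ _ _).mp hy
        obtain ⟨y, rfl⟩ := Submodule.Quotient.mk_surjective _ y
        rw [LinearMap.mem_ker, ← Submodule.Quotient.mk_smul]
        exact (Submodule.Quotient.mk_eq_zero _).mpr (q.asIdeal.mul_mem_right y hxq)
      · rw [← LinearMap.range_eq_top, Submodule.range_liftQ, LinearMap.range_eq_top]
        exact Submodule.factor_surjective hle
    -- The stride covers both the Artin–Rees shift `k` and the progression `K` of `q`.
    refine ⟨a, k + K, fun t => ?_⟩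
    induction t with
    | zero => simp
    | succ t iht =>
      calc (((t + 1).choose (d + 1) : ℕ) : ℕ∞)
          = (t.choose (d + 1) : ℕ∞) + (t.choose d : ℕ∞) := by
            rw [Nat.choose_succ_succ, Nat.cast_add, add_comm]
        _ ≤ hilbertSamuel J (R ⧸ p.asIdeal) (a + (k + K) * t) +
            hilbertSamuel J (QuotSMulTop x (R ⧸ p.asIdeal)) (a + (k + K) * t + k) := by
            refine add_le_add iht ((h t).trans ((hilbertSamuel_mono J ?_).trans (hsurj _)))
            nlinarith
        _ ≤ _ := (hk _).trans (hilbertSamuel_mono J (by nlinarith))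

/-- A minimal prime `q` of the annihilator below a chain of length `d` in the support is associated,
so `R ⧸ q` embeds in `M`; Artin–Rees transfers its lower bound. -/
lemma exists_choose_supportDim_le_hilbertSamuel {J : Ideal R} (hJ : J ≤ maximalIdeal R) (d : ℕ)
    [Module.Finite R M] (hd : (d : WithBot ℕ∞) ≤ Module.supportDim R M) :
    ∃ a K : ℕ, ∀ t : ℕ, (t.choose d : ℕ∞) ≤ hilbertSamuel J M (a + K * t) := by
  obtain ⟨l, hl⟩ := Order.le_krullDim_iff.mp hd
  obtain ⟨q, hq, hql⟩ := Ideal.exists_minimalPrimes_le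
    (Module.mem_support_iff_of_finite.mp l.head.2)
  obtain ⟨hqp, f, hf⟩ := (isAssociatedPrime_iff_exists_injective_linearMap _ _).mp
    (Module.associatedPrimes.minimalPrimes_annihilator_subset_associatedPrimes R M hq)
  have hco : (d : ℕ∞) ≤ Order.coheight (⟨q, hqp⟩ : PrimeSpectrum R) := by
    have := Order.length_le_coheight (x := (⟨q, hqp⟩ : PrimeSpectrum R))
      (p := l.map (fun p => p.1) (fun _ _ h => h)) hql
    exact hl ▸ this
  obtain ⟨a, K, h⟩ := exists_choose_le_hilbertSamuel hJ d _ hco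
  obtain ⟨k, hk⟩ := exists_hilbertSamuel_add_le J f hf _
    (Submodule.mkQ_surjective _) (LinearMap.exact_map_mkQ_range f)
  refine ⟨a + k, K, fun t => (h t).trans (le_self_add.trans ((hk _).trans ?_))⟩
  exact hilbertSamuel_mono J (by omega)

end Local

end HilbertSamuel

/-! ### Eventually polynomial functions and their differences -/

section PolynomialFunctions

variable {σ : Type*}

open MvPolynomial Filter Topology in
-- The limit depends on the direction `v` but not on the base point `u`; this is what allows
-- different residue classes to be compared.
lemma MvPolynomial.tendsto_eval_div_pow [Fintype σ] {Q : MvPolynomial σ ℚ} {D : ℕ} (hQ : Q.totalDegree ≤ D)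
    (u v : σ → ℚ) :
    Tendsto (fun s : ℕ => eval (fun j => u j + s * v j) Q / (s : ℚ) ^ D) atTop
      (𝓝 (eval v (homogeneousComponent D Q))) := by
  have hinv : Tendsto (fun s : ℕ => ((s : ℚ))⁻¹) atTop (𝓝 0) :=
    tendsto_inv_atTop_zero.comp tendsto_natCast_atTop_atTop
  have hev : eval v (homogeneousComponent D Q) =
      ∑ m ∈ Q.support, (if m.degree = D then coeff m Q * ∏ i, v i ^ m i else 0) := by
    rw [homogeneousComponent_apply, map_sum, ← Finset.sum_filter]
    refine Finset.sum_congr rfl fun m _ => ?_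
    rw [eval_monomial, Finsupp.prod_fintype _ _ (by simp)]
  rw [hev]
  simp_rw [eval_eq', Finset.sum_div]
  refine tendsto_finsetSum _ fun m hm => ?_
  have hmD : m.degree ≤ D := (le_totalDegree hm).trans hQ
  -- A monomial of degree `e ≤ D` divided by `s^D` is its value at `u/s + v` times `s^(-(D - e))`.
  have hmain : Tendsto (fun s : ℕ => coeff m Q * (∏ i, (u i * (s : ℚ)⁻¹ + v i) ^ m i) *
      ((s : ℚ)⁻¹) ^ (D - m.degree)) atTop
      (𝓝 (coeff m Q * (∏ i, (u i * 0 + v i) ^ m i) * 0 ^ (D - m.degree))) :=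
    ((tendsto_const_nhds.mul (tendsto_finsetProd _ fun i _ =>
      ((tendsto_const_nhds.mul hinv).add tendsto_const_nhds).pow _)).mul (hinv.pow _))
  have hlim : coeff m Q * (∏ i, (u i * 0 + v i) ^ m i) * 0 ^ (D - m.degree) =
      if m.degree = D then coeff m Q * ∏ i, v i ^ m i else 0 := by
    split_ifs with h
    · simp [h]
    · rw [zero_pow (by omega), mul_zero]
  rw [← hlim]
  refine hmain.congr' ?_
  filter_upwards [eventually_gt_atTop 0] with s hs
  have hs0 : (s : ℚ) ≠ 0 := by positivity
  have h1 : ∀ i, (u i * (s : ℚ)⁻¹ + v i) ^ m i = (u i + s * v i) ^ m i * ((s : ℚ)⁻¹) ^ m i := by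
    intro i
    rw [← mul_pow]
    congr 1
    field_simp
  simp_rw [h1, Finset.prod_mul_distrib, Finset.prod_pow_eq_pow_sum]
  rw [← Finsupp.degree_eq_sum, mul_assoc, mul_assoc, ← pow_add, Nat.add_sub_cancel' hmD, inv_pow, div_eq_mul_inv,
    mul_assoc]

/-- `f : ℕˢ → ℚ` is given by a polynomial for all arguments with large coordinates. -/
def IsEventuallyPolynomial (f : (σ → ℕ) → ℚ) : Prop :=
  ∃ (c : ℕ) (Q : MvPolynomial σ ℚ), ∀ n : σ → ℕ, (∀ j, c ≤ n j) →
    f n = MvPolynomial.eval (fun j => (n j : ℚ)) Q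

lemma IsEventuallyPolynomial.sub {f g : (σ → ℕ) → ℚ} (hf : IsEventuallyPolynomial f)
    (hg : IsEventuallyPolynomial g) : IsEventuallyPolynomial fun n => f n - g n := by
  obtain ⟨c, P, hP⟩ := hf
  obtain ⟨d, Q, hQ⟩ := hg
  refine ⟨max c d, P - Q, fun n hn => ?_⟩
  beta_reduce
  rw [hP n fun j => (le_max_left _ _).trans (hn j), hQ n fun j => (le_max_right _ _).trans (hn j),
    map_sub]

lemma MvPolynomial.eval_bind₁ {τ S : Type*} [CommRing S] (x : τ → S) (g : σ → MvPolynomial τ S)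
    (P : MvPolynomial σ S) : eval x (bind₁ g P) = eval (fun i => eval x (g i)) P :=
  eval₂Hom_bind₁ _ _ _ _

lemma IsEventuallyPolynomial.comp_add {f : (σ → ℕ) → ℚ} (hf : IsEventuallyPolynomial f)
    (m : σ → ℕ) : IsEventuallyPolynomial fun n => f (n + m) := by
  obtain ⟨c, P, hP⟩ := hf
  refine ⟨c, MvPolynomial.bind₁ (fun j => MvPolynomial.X j + MvPolynomial.C (m j : ℚ)) P,
    fun n hn => ?_⟩
  beta_reduce
  rw [hP (n + m) fun j => (hn j).trans (Nat.le_add_right _ _), MvPolynomial.eval_bind₁]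
  simp

variable [Fintype σ] [DecidableEq σ]

lemma Polynomial.exists_eval_eq_sum_range_pow (p : ℕ) :
    ∃ F : ℚ[X], ∀ n : ℕ, F.eval (n : ℚ) = ∑ k ∈ Finset.range n, (k : ℚ) ^ p := by
  refine ⟨∑ i ∈ Finset.range (p + 1),
    Polynomial.C (_root_.bernoulli i * ((p + 1).choose i) / (p + 1)) * X ^ (p + 1 - i), fun n => ?_⟩
  rw [sum_range_pow, Polynomial.eval_finsetSum]
  refine Finset.sum_congr rfl fun i _ => ?_
  simp only [eval_mul, eval_C, eval_pow, eval_X]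
  ring

/-- Discrete integration in the variable `j`, monomial by monomial, through the Faulhaber
polynomials. -/
lemma MvPolynomial.exists_eval_eq_sum_Ico (Q : MvPolynomial σ ℚ) (j : σ) (c : ℕ) :
    ∃ Q' : MvPolynomial σ ℚ, ∀ n : σ → ℕ, c ≤ n j →
      ∑ k ∈ Finset.Ico c (n j), eval (fun i => (Function.update n j k i : ℚ)) Q =
        eval (fun i => (n i : ℚ)) Q' := by
  induction Q using MvPolynomial.induction_on' with
  | monomial s a =>
    obtain ⟨F, hF⟩ := Polynomial.exists_eval_eq_sum_range_pow (s j)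
    refine ⟨C a * (Polynomial.aeval (X j : MvPolynomial σ ℚ) F - C (F.eval (c : ℚ))) * ∏ i ∈ Finset.univ.erase j, X i ^ s i,
      fun n hn => ?_⟩
    have h1 : eval (fun i => (n i : ℚ)) (Polynomial.aeval (X j : MvPolynomial σ ℚ) F) = F.eval (n j : ℚ) := by
      rw [← coe_aeval_eq_eval, RingHom.coe_coe, ← Polynomial.aeval_algHom_apply]
      simp
    have h2 : ∀ k, eval (fun i => (Function.update n j k i : ℚ)) (monomial s a) =
        a * (∏ i ∈ Finset.univ.erase j, (n i : ℚ) ^ s i) * (k : ℚ) ^ s j := by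
      intro k
      rw [eval_monomial, Finsupp.prod_fintype _ _ (by simp),
        ← Finset.prod_erase_mul _ _ (Finset.mem_univ j), Function.update_self, mul_assoc]
      congr 2
      refine Finset.prod_congr rfl fun i hi => ?_
      rw [Function.update_of_ne (Finset.ne_of_mem_erase hi)]
    simp_rw [h2]
    rw [← Finset.mul_sum, Finset.sum_Ico_eq_sub _ hn, ← hF, ← hF]
    simp only [map_mul, map_sub, map_prod, map_pow, eval_C, eval_X, h1]
    ring
  | add P Q hP hQ =>
    obtain ⟨P', hP'⟩ := hP
    obtain ⟨Q', hQ'⟩ := hQ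
    refine ⟨P' + Q', fun n hn => ?_⟩
    simp only [map_add, Finset.sum_add_distrib, hP' n hn, hQ' n hn]

/-- Coordinates outside `T` are frozen at `c`. Enlarging `T` by `j` means walking from `c` to `n j`
in that coordinate and summing the polynomial differences met on the way. -/
lemma exists_mvPolynomial_of_forall_difference {f : (σ → ℕ) → ℚ} {c : ℕ}
    (h : ∀ j, ∃ Q : MvPolynomial σ ℚ, ∀ n : σ → ℕ, (∀ i, c ≤ n i) →
      f (n + Pi.single j 1) - f n = MvPolynomial.eval (fun i => (n i : ℚ)) Q) (T : Finset σ) :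
    ∃ Q : MvPolynomial σ ℚ, ∀ n : σ → ℕ, (∀ i, c ≤ n i) →
      f (fun i => if i ∈ T then n i else c) = MvPolynomial.eval (fun i => (n i : ℚ)) Q := by
  induction T using Finset.induction_on with
  | empty => exact ⟨MvPolynomial.C (f fun _ => c), fun n _ => by simp⟩
  | insert j T hj ih =>
    obtain ⟨P, hP⟩ := ih
    obtain ⟨Q, hQ⟩ := h j
    obtain ⟨Q', hQ'⟩ := MvPolynomial.exists_eval_eq_sum_Ico
      (MvPolynomial.bind₁ (fun i => if i ∈ insert j T then MvPolynomial.X i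
        else MvPolynomial.C (c : ℚ)) Q) j c
    refine ⟨P + Q', fun n hn => ?_⟩
    have hstep : ∀ k, c ≤ k →
        f (fun i => if i ∈ insert j T then Function.update n j k i else c) =
          f (fun i => if i ∈ T then n i else c) + ∑ l ∈ Finset.Ico c k,
            MvPolynomial.eval (fun i => (Function.update n j l i : ℚ))
              (MvPolynomial.bind₁ (fun i => if i ∈ insert j T then MvPolynomial.X i
                else MvPolynomial.C (c : ℚ)) Q) := by
      intro k hk
      induction k, hk using Nat.le_induction with
      | base =>
        simp only [Finset.Ico_self, Finset.sum_empty, add_zero]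
        congr 1
        funext i
        by_cases hij : i = j
        · subst hij; simp [hj]
        · simp [hij]
      | succ k hk ihk =>
        rw [Finset.sum_Ico_succ_top hk, ← add_assoc, ← ihk, ← sub_eq_iff_eq_add']
        have hshift : (fun i => if i ∈ insert j T then Function.update n j (k + 1) i else c) =
            (fun i => if i ∈ insert j T then Function.update n j k i else c) + Pi.single j 1 := by
          funext i
          by_cases hij : i = j
          · subst hij; simp
          · simp [hij]
        rw [hshift, hQ _ ?_]
        · rw [MvPolynomial.eval_bind₁]
          congr 2
          funext i
          split_ifs <;> simp
        · intro i
          by_cases hij : i = j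
          · subst hij; simpa using hk
          · simp only [Function.update_of_ne hij]
            split_ifs
            exacts [hn i, le_rfl]
    have := hstep (n j) (hn j)
    rw [Function.update_eq_self] at this
    rw [this, hP n hn, hQ' n (hn j), map_add]

lemma IsEventuallyPolynomial.of_difference {f : (σ → ℕ) → ℚ}
    (h : ∀ j, IsEventuallyPolynomial fun n => f (n + Pi.single j 1) - f n) :
    IsEventuallyPolynomial f := by
  choose c Q hQ using h
  obtain ⟨P, hP⟩ := exists_mvPolynomial_of_forall_difference (f := f) (c := ∑ j, c j)
    (fun j => ⟨Q j, fun n hn => hQ j n fun i =>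
      (Finset.single_le_sum (fun _ _ => Nat.zero_le _) (Finset.mem_univ j)).trans (hn i)⟩)
    Finset.univ
  exact ⟨_, P, fun n hn => by simpa using hP n hn⟩

end PolynomialFunctions

/-! ### Relative lengths of submodules -/

section RelativeLength

variable {R : Type*} [CommRing R] {M : Type*} [AddCommGroup M] [Module R M]

/-- The length of `A / (A ∩ B)` for submodules `A`, `B` of a module. -/
noncomputable def relLength (A B : Submodule R M) : ℕ∞ :=
  Module.length R (A ⧸ B.comap A.subtype)

lemma relLength_eq_zero {A B : Submodule R M} (h : A ≤ B) : relLength A B = 0 := by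
  rw [relLength, Module.length_eq_zero_iff, Submodule.Quotient.subsingleton_iff,
    Submodule.comap_subtype_eq_top]
  exact h

lemma relLength_eq_add {A B C : Submodule R M} (hBC : B ≤ C) (hCA : C ≤ A) :
    relLength A B = relLength C B + relLength A C := by
  refine Module.length_eq_add_of_exact
    (Submodule.mapQ (B.comap C.subtype) (B.comap A.subtype) (Submodule.inclusion hCA)
      (fun _ h => h))
    (Submodule.factor (Submodule.comap_mono hBC)) ?_ (Submodule.factor_surjective _) ?_
  · rw [injective_iff_map_eq_zero]
    rintro ⟨c⟩ h
    have h1 : Submodule.inclusion hCA c ∈ B.comap A.subtype := (Submodule.Quotient.mk_eq_zero _).mp h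
    exact (Submodule.Quotient.mk_eq_zero _).mpr h1
  · rintro ⟨a⟩
    constructor
    · intro h
      have h1 : a ∈ C.comap A.subtype := (Submodule.Quotient.mk_eq_zero _).mp h
      exact ⟨Submodule.Quotient.mk ⟨a.1, h1⟩, rfl⟩
    · rintro ⟨⟨b⟩, hb⟩
      rw [← hb]
      exact (Submodule.Quotient.mk_eq_zero _).mpr b.2

lemma relLength_sup_map (A B : Submodule R M) (f : M →ₗ[R] M) :
    relLength (B ⊔ A.map f) B = relLength A (A ⊓ B.comap f) := by
  have hmem : ∀ a : A, f a ∈ B ⊔ A.map f := fun a =>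
    Submodule.mem_sup_right ⟨a, a.2, rfl⟩
  let g : A →ₗ[R] (B ⊔ A.map f : Submodule R M) ⧸ B.comap (B ⊔ A.map f).subtype :=
    (Submodule.mkQ _).comp ((f.domRestrict A).codRestrict _ hmem)
  have hg : Function.Surjective g := by
    rintro ⟨⟨y, hy⟩⟩
    obtain ⟨b, hb, _, ⟨a, ha, rfl⟩, rfl⟩ := Submodule.mem_sup.mp hy
    refine ⟨⟨a, ha⟩, (Submodule.Quotient.eq _).mpr ?_⟩
    change f a - (b + f a) ∈ B
    rw [sub_add_cancel_right]
    exact neg_mem hb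
  have hker : LinearMap.ker g = (A ⊓ B.comap f).comap A.subtype := by
    ext a
    rw [LinearMap.mem_ker]
    refine (Submodule.Quotient.mk_eq_zero _).trans ?_
    change f a ∈ B ↔ a.1 ∈ A ∧ f a.1 ∈ B
    simp
  unfold relLength
  rw [← hker]
  exact (g.quotKerEquivOfSurjective hg).length_eq.symm

/-- Additivity of length on the four-term exact sequence of kernel, source, target and cokernel of
`A/B → A'/B'` induced by `f`, written without subtraction since lengths lie in `ℕ∞`. -/
lemma relLength_add_relLength (A A' B B' : Submodule R M) (f : M →ₗ[R] M) (hB : B ≤ A)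
    (hB' : B' ≤ A') (hA : A.map f ≤ A') (hf : B.map f ≤ B') :
    relLength A' B' + relLength (A ⊓ B'.comap f) B = relLength A' (B' ⊔ A.map f) + relLength A B := by
  rw [relLength_eq_add le_sup_left (sup_le hB' hA), relLength_sup_map,
    relLength_eq_add (A := A) (le_inf hB (Submodule.map_le_iff_le_comap.mp hf)) inf_le_left]
  ring

end RelativeLength

/-! ### Multigraded modules as stable families, and the Hilbert–Serre induction -/

section StableFamilies

variable {R : Type*} [CommRing R] {M : Type*} [AddCommGroup M] [Module R M]
variable {σ ι : Type*}

/-- The ideal generated by the `xᵢ` of degree `j`. -/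
def degreeIdeal (x : ι → R) (deg : ι → σ) (j : σ) : Ideal R :=
  Ideal.span (x '' {i | deg i = j})

lemma degreeIdeal_smul_le {x : ι → R} {deg : ι → σ} {j : σ} {P Q : Submodule R M}
    (h : ∀ i, deg i = j → P.map (LinearMap.lsmul R M (x i)) ≤ Q) :
    degreeIdeal x deg j • P ≤ Q := by
  refine Submodule.smul_le.mpr fun a ha v hv => ?_
  induction ha using Submodule.span_induction with
  | mem a ha =>
    obtain ⟨i, hi, rfl⟩ := ha
    exact h i hi ⟨v, hv, rfl⟩
  | zero => simp
  | add a b _ _ ha hb => rw [add_smul]; exact add_mem ha hb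
  | smul c a _ ha => rw [smul_eq_mul, mul_smul]; exact Q.smul_mem c ha

variable [DecidableEq σ]

/-- A family of submodules indexed by `ℕˢ` is stable if multiplication by `xᵢ` raises the
coordinate `deg i` by one. -/
def IsStableFamily (x : ι → R) (deg : ι → σ) (A : (σ → ℕ) → Submodule R M) : Prop :=
  ∀ i n, (A n).map (LinearMap.lsmul R M (x i)) ≤ A (n + Pi.single (deg i) 1)

/-- The ascending chain condition for stable subfamilies of `A`. -/
def StableFamilyACC (x : ι → R) (deg : ι → σ) (A : (σ → ℕ) → Submodule R M) : Prop :=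
  ∀ G : ℕ → (σ → ℕ) → Submodule R M, Monotone G → (∀ k, IsStableFamily x deg (G k)) →
    (∀ k, G k ≤ A) → ∃ c, ∀ k, c ≤ k → G k = G c

variable {x : ι → R} {deg : ι → σ} {A B : (σ → ℕ) → Submodule R M}

lemma StableFamilyACC.mono (hA : StableFamilyACC x deg A) (hB : B ≤ A) :
    StableFamilyACC x deg B :=
  fun G hG hs hle => hA G hG hs fun k => (hle k).trans hB

lemma IsStableFamily.degreeIdeal_smul_le (hA : IsStableFamily x deg A) (j : σ) (n : σ → ℕ) :
    degreeIdeal x deg j • A n ≤ A (n + Pi.single j 1) :=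
  _root_.degreeIdeal_smul_le fun i hi => hi ▸ hA i n

/-- The subfamily generated by the members of `A` whose `j`-th index is at most `c`. -/
def truncatedFamily (x : ι → R) (deg : ι → σ) (A : (σ → ℕ) → Submodule R M) (j : σ) (c : ℕ)
    (n : σ → ℕ) : Submodule R M :=
  degreeIdeal x deg j ^ (n j - c) • A (Function.update n j (min (n j) c))

lemma truncatedFamily_of_le {j : σ} {c : ℕ} {n : σ → ℕ} (h : n j ≤ c) :
    truncatedFamily x deg A j c n = A n := by
  simp [truncatedFamily, h]

lemma truncatedFamily_add_single {j : σ} {c : ℕ} {n : σ → ℕ} (h : c ≤ n j) :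
    truncatedFamily x deg A j c (n + Pi.single j 1) =
      degreeIdeal x deg j • truncatedFamily x deg A j c n := by
  unfold truncatedFamily
  rw [← mul_smul, ← pow_succ']
  congr 2
  · simp; omega
  · funext i
    by_cases hij : i = j
    · subst hij; simp; omega
    · simp [hij]

lemma IsStableFamily.truncatedFamily_mono (hA : IsStableFamily x deg A) (j : σ) :
    Monotone (truncatedFamily x deg A j) := by
  refine monotone_nat_of_le_succ fun c n => ?_
  rcases le_or_gt (n j) c with h | h
  · rw [truncatedFamily_of_le h, truncatedFamily_of_le (h.trans (Nat.le_succ c))]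
  · unfold truncatedFamily
    rw [show n j - c = (n j - (c + 1)) + 1 by omega, pow_succ, mul_smul]
    refine Submodule.smul_mono le_rfl ((hA.degreeIdeal_smul_le j _).trans (le_of_eq ?_))
    congr 1
    funext i
    by_cases hij : i = j
    · subst hij; simp; omega
    · simp [hij]

lemma IsStableFamily.isStableFamily_truncatedFamily (hA : IsStableFamily x deg A) (j : σ) (c : ℕ) :
    IsStableFamily x deg (truncatedFamily x deg A j c) := by
  intro i n
  by_cases hi : deg i = j
  · rcases lt_or_ge (n j) c with h | h
    · rw [truncatedFamily_of_le h.le, truncatedFamily_of_le (by simp [hi]; omega)]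
      exact hA i n
    · rw [hi, truncatedFamily_add_single h]
      rintro _ ⟨v, hv, rfl⟩
      exact Submodule.smul_mem_smul (Ideal.subset_span ⟨i, hi, rfl⟩) hv
  · unfold truncatedFamily
    rw [Submodule.map_smul'']
    have h1 : (n + Pi.single (deg i) 1 : σ → ℕ) j = n j := by simp [Ne.symm hi]
    rw [h1]
    refine Submodule.smul_mono le_rfl ((hA i _).trans (le_of_eq ?_))
    congr 1
    funext l
    by_cases hl : l = j
    · subst hl; simp [Ne.symm hi]
    · simp [hl]

/-- The truncations in direction `j` form an ascending chain of stable subfamilies. Once it is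
stationary, truncating at `n j` and at `n j + 1` gives the same member at `n + e_j`: the former is
`J_j A n`, the latter `A (n + e_j)`. -/
lemma StableFamilyACC.exists_eq_smul (hacc : StableFamilyACC x deg A)
    (hA : IsStableFamily x deg A) (j : σ) :
    ∃ c, ∀ n : σ → ℕ, c ≤ n j → A (n + Pi.single j 1) = degreeIdeal x deg j • A n := by
  have hle : ∀ c, truncatedFamily x deg A j c ≤ A := by
    intro c n
    rw [← truncatedFamily_of_le (x := x) (deg := deg) (A := A) (le_max_right c (n j))]
    exact hA.truncatedFamily_mono j (le_max_left _ _) n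
  obtain ⟨c, hc⟩ := hacc (truncatedFamily x deg A j) (hA.truncatedFamily_mono j)
    (hA.isStableFamily_truncatedFamily j) hle
  refine ⟨c, fun n hn => ?_⟩
  have h1 := congrFun (hc (n j) hn) (n + Pi.single j 1)
  have h2 := congrFun (hc (n j + 1) (by omega)) (n + Pi.single j 1)
  rw [← h1, truncatedFamily_of_le (by simp), truncatedFamily_add_single le_rfl,
    truncatedFamily_of_le le_rfl] at h2
  exact h2

/-- The family `B + xᵢ A`. -/
def cokernelFamily (x : ι → R) (deg : ι → σ) (A B : (σ → ℕ) → Submodule R M) (i : ι)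
    (m : σ → ℕ) : Submodule R M :=
  B m ⊔ ⨆ (n : σ → ℕ) (_ : n + Pi.single (deg i) 1 = m), (A n).map (LinearMap.lsmul R M (x i))

/-- The family of elements of `A` mapped into `B` by `xᵢ`. -/
def kernelFamily (x : ι → R) (deg : ι → σ) (A B : (σ → ℕ) → Submodule R M) (i : ι)
    (n : σ → ℕ) : Submodule R M :=
  A n ⊓ (B (n + Pi.single (deg i) 1)).comap (LinearMap.lsmul R M (x i))

lemma cokernelFamily_add_single (i : ι) (n : σ → ℕ) :
    cokernelFamily x deg A B i (n + Pi.single (deg i) 1) =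
      B (n + Pi.single (deg i) 1) ⊔ (A n).map (LinearMap.lsmul R M (x i)) := by
  simp [cokernelFamily]

lemma IsStableFamily.isStableFamily_cokernelFamily (hA : IsStableFamily x deg A)
    (hB : IsStableFamily x deg B) (i : ι) :
    IsStableFamily x deg (cokernelFamily x deg A B i) := by
  intro i' m
  rw [cokernelFamily, Submodule.map_sup]
  refine sup_le ((hB i' m).trans le_sup_left) ?_
  simp only [Submodule.map_iSup]
  refine iSup₂_le fun n hn => ?_
  subst hn
  rw [add_right_comm, cokernelFamily_add_single]
  refine le_trans ?_ ((Submodule.map_mono (hA i' n)).trans le_sup_right)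
  rintro _ ⟨_, ⟨v, hv, rfl⟩, rfl⟩
  exact ⟨_, ⟨v, hv, rfl⟩, smul_comm _ _ _⟩

lemma IsStableFamily.isStableFamily_kernelFamily (hA : IsStableFamily x deg A)
    (hB : IsStableFamily x deg B) (i : ι) :
    IsStableFamily x deg (kernelFamily x deg A B i) := by
  rintro i' n _ ⟨v, ⟨hv, hv'⟩, rfl⟩
  refine ⟨hA i' n ⟨v, hv, rfl⟩, ?_⟩
  rw [add_right_comm]
  refine hB i' _ ⟨_, hv', smul_comm _ _ _⟩

/-- Induction on the set `T` of variables that may act nontrivially on `A/B`. If every direction has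
a variable in `T`, the difference in that direction is a cokernel length minus a kernel length, and
both families lose the variable from `T`. If some direction has none, `A/B` vanishes far out in that
direction. -/
theorem isEventuallyPolynomial_relLength [Fintype σ] (T : Finset ι)
    (hA : IsStableFamily x deg A) (hB : IsStableFamily x deg B) (hBA : B ≤ A)
    (hacc : StableFamilyACC x deg A) (hfin : ∀ n, relLength (A n) (B n) ≠ ⊤)
    (hT : ∀ i ∉ T, ∀ n, (A n).map (LinearMap.lsmul R M (x i)) ≤ B (n + Pi.single (deg i) 1)) :
    IsEventuallyPolynomial fun n => ((relLength (A n) (B n)).toNat : ℚ) := by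
  classical
  induction T using Finset.strongInduction generalizing A B with
  | H T ih =>
    by_cases hcase : ∀ j, ∃ i ∈ T, deg i = j
    · refine IsEventuallyPolynomial.of_difference fun j => ?_
      obtain ⟨i, hiT, rfl⟩ := hcase j
      have hle : cokernelFamily x deg A B i ≤ A := by
        refine fun m => sup_le (hBA m) (iSup₂_le fun n hn => ?_)
        rw [← hn]
        exact hA i n
      have key : ∀ n, relLength (A (n + Pi.single (deg i) 1)) (B (n + Pi.single (deg i) 1)) +
          relLength (kernelFamily x deg A B i n) (B n) =
          relLength (A (n + Pi.single (deg i) 1))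
            (cokernelFamily x deg A B i (n + Pi.single (deg i) 1)) + relLength (A n) (B n) := by
        intro n
        rw [cokernelFamily_add_single]
        exact relLength_add_relLength _ _ _ _ _ (hBA _) (hBA _) (hA i n) (hB i n)
      have hker_le : ∀ n, B n ≤ kernelFamily x deg A B i n := fun n =>
        le_inf (hBA n) (Submodule.map_le_iff_le_comap.mp (hB i n))
      have hfinK : ∀ n, relLength (kernelFamily x deg A B i n) (B n) ≠ ⊤ := fun n =>
        ne_top_of_le_ne_top (hfin n)
          (le_self_add.trans (relLength_eq_add (hker_le n) inf_le_left).ge)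
      have hfinC : ∀ n, relLength (A n) (cokernelFamily x deg A B i n) ≠ ⊤ := fun n =>
        ne_top_of_le_ne_top (hfin n)
          (le_add_self.trans (relLength_eq_add le_sup_left (hle n)).ge)
      have hK := ih (T.erase i) (Finset.erase_ssubset hiT)
        (hA.isStableFamily_kernelFamily hB i) hB hker_le (hacc.mono fun n => inf_le_left) hfinK
        (by
          intro i' hi' n
          by_cases hii : i' = i
          · subst hii
            exact Submodule.map_le_iff_le_comap.mpr inf_le_right
          · exact (Submodule.map_mono inf_le_left).trans
              (hT i' (fun h => hi' (Finset.mem_erase.mpr ⟨hii, h⟩)) n))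
      have hC := ih (T.erase i) (Finset.erase_ssubset hiT) hA
        (hA.isStableFamily_cokernelFamily hB i) hle hacc hfinC
        (by
          intro i' hi' n
          by_cases hii : i' = i
          · subst hii
            rw [cokernelFamily_add_single]
            exact le_sup_right
          · exact (hT i' (fun h => hi' (Finset.mem_erase.mpr ⟨hii, h⟩)) n).trans le_sup_left)
      convert (hC.comp_add (Pi.single (deg i) 1)).sub hK using 2 with n
      have := congrArg ENat.toNat (key n)
      rw [ENat.toNat_add (hfin _) (hfinK _), ENat.toNat_add (hfinC _) (hfin _)] at this
      rw [sub_eq_sub_iff_add_eq_add]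
      exact_mod_cast this
    · push Not at hcase
      obtain ⟨j, hj⟩ := hcase
      obtain ⟨c, hc⟩ := hacc.exists_eq_smul hA j
      -- Past `c + 1`, `n = m + e_j` with `m j ≥ c`, so `A n = J_j A m`, which lies in `B n`.
      refine ⟨c + 1, 0, fun n hn => ?_⟩
      obtain ⟨m, rfl⟩ : ∃ m : σ → ℕ, n = m + Pi.single j 1 := by
        refine ⟨n - Pi.single j 1, funext fun i => ?_⟩
        by_cases hij : i = j
        · subst hij
          have := hn i
          simp; omega
        · simp [hij]
      have hcm : c ≤ m j := by
        have := hn j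
        simp at this
        omega
      have hle : A (m + Pi.single j 1) ≤ B (m + Pi.single j 1) := by
        rw [hc m hcm]
        refine degreeIdeal_smul_le fun i hi => ?_
        rw [← hi]
        exact hT i (fun h => hj i h hi) m
      simp [relLength_eq_zero hle]

section ReesFamily

open MvPolynomial

/-- The multidegree of the `i`-th variable. -/
def multiWeight (deg : ι → σ) (i : ι) : σ → ℕ := Pi.single (deg i) 1

lemma weightedHomogeneousComponent_X_mul (i : ι) (m : σ → ℕ) (q : MvPolynomial ι R) :
    weightedHomogeneousComponent (multiWeight deg) (m + multiWeight deg i) (X i * q) =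
      X i * weightedHomogeneousComponent (multiWeight deg) m q := by
  classical
  ext d
  rw [coeff_weightedHomogeneousComponent, coeff_X_mul', coeff_X_mul',
    coeff_weightedHomogeneousComponent]
  by_cases hd : i ∈ d.support
  · have hd' : d = (d - Finsupp.single i 1) + Finsupp.single i 1 :=
      (tsub_add_cancel_of_le (Finsupp.single_le_iff.mpr
        (Nat.one_le_iff_ne_zero.mpr (Finsupp.mem_support_iff.mp hd)))).symm
    have hw : Finsupp.weight (multiWeight deg) d =
        Finsupp.weight (multiWeight deg) (d - Finsupp.single i 1) + multiWeight deg i := by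
      conv_lhs => rw [hd', map_add]
      simp [Finsupp.weight_single]
    rw [hw]
    simp only [add_left_inj, if_pos hd]
  · simp [hd]

lemma weightedHomogeneousComponent_X_mul_of_forall_ne (i : ι) (n : σ → ℕ) (q : MvPolynomial ι R)
    (h : ∀ m, m + multiWeight deg i ≠ n) :
    weightedHomogeneousComponent (multiWeight deg) n (X i * q) = 0 := by
  classical
  ext d
  rw [coeff_weightedHomogeneousComponent, coeff_X_mul', MvPolynomial.coeff_zero]
  by_cases hd : i ∈ d.support
  · have hd' : d = (d - Finsupp.single i 1) + Finsupp.single i 1 :=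
      (tsub_add_cancel_of_le (Finsupp.single_le_iff.mpr
        (Nat.one_le_iff_ne_zero.mpr (Finsupp.mem_support_iff.mp hd)))).symm
    have hw : Finsupp.weight (multiWeight deg) d =
        Finsupp.weight (multiWeight deg) (d - Finsupp.single i 1) + multiWeight deg i := by
      conv_lhs => rw [hd', map_add]
      simp [Finsupp.weight_single]
    rw [hw, if_neg (h _)]
  · simp [hd]

/-- Evaluation of the part of multidegree `n` of a vector of polynomials. -/
noncomputable def componentEval (x : ι → R) (deg : ι → σ) {k : ℕ} (g : Fin k → M) (n : σ → ℕ) :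
    (Fin k → MvPolynomial ι R) →ₗ[R] M :=
  ∑ l, (LinearMap.toSpanSingleton R M (g l)) ∘ₗ (MvPolynomial.aeval x).toLinearMap ∘ₗ
    weightedHomogeneousComponent (multiWeight deg) n ∘ₗ LinearMap.proj l

lemma componentEval_apply {k : ℕ} (g : Fin k → M) (n : σ → ℕ) (p : Fin k → MvPolynomial ι R) :
    componentEval x deg g n p =
      ∑ l, MvPolynomial.aeval x (weightedHomogeneousComponent (multiWeight deg) n (p l)) • g l := by
  simp [componentEval]

/-- The module of vectors of polynomials whose evaluation in each multidegree lies in `G`. -/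
noncomputable def IsStableFamily.toSubmodule {G : (σ → ℕ) → Submodule R M} (hG : IsStableFamily x deg G)
    {k : ℕ} (g : Fin k → M) : Submodule (MvPolynomial ι R) (Fin k → MvPolynomial ι R) where
  carrier := {p | ∀ n, componentEval x deg g n p ∈ G n}
  add_mem' := fun hp hq n => by
    rw [map_add]
    exact add_mem (hp n) (hq n)
  zero_mem' := fun n => by simp
  smul_mem' := by
    intro q p hp
    induction q using MvPolynomial.induction_on generalizing p with
    | C a =>
      intro n
      have : (MvPolynomial.C a : MvPolynomial ι R) • p = a • p := by
        ext l : 1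
        rw [Pi.smul_apply, Pi.smul_apply, smul_eq_mul, MvPolynomial.C_mul']
      rw [this, map_smul]
      exact (G n).smul_mem a (hp n)
    | add q q' hq hq' =>
      intro n
      rw [add_smul, map_add]
      exact add_mem (hq hp n) (hq' hp n)
    | mul_X q i hq =>
      rw [mul_smul]
      -- It suffices to multiply by one variable, which shifts multidegrees by `e_{deg i}`; in
      -- multidegrees not reached by the shift the component is zero.
      refine hq (p := X i • p) fun n => ?_
      rw [componentEval_apply]
      by_cases h : ∃ m, m + multiWeight deg i = n
      · obtain ⟨m, rfl⟩ := h
        have := hG i m ⟨_, hp m, rfl⟩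
        rw [componentEval_apply, LinearMap.lsmul_apply, Finset.smul_sum] at this
        change _ ∈ G (m + Pi.single (deg i) 1)
        refine (congrArg (· ∈ G (m + Pi.single (deg i) 1)) (Finset.sum_congr rfl fun l _ => ?_)).mpr
          this
        rw [Pi.smul_apply, smul_eq_mul, weightedHomogeneousComponent_X_mul, map_mul, MvPolynomial.aeval_X,
          mul_smul]
      · push Not at h
        simp only [Pi.smul_apply, smul_eq_mul,
          weightedHomogeneousComponent_X_mul_of_forall_ne i n _ h, map_zero, zero_smul,
          Finset.sum_const_zero, zero_mem]

/-- The values at `x` of the polynomials of multidegree `n`. -/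
noncomputable def valueIdeal (x : ι → R) (deg : ι → σ) (n : σ → ℕ) : Ideal R :=
  (weightedHomogeneousSubmodule R (multiWeight deg) n).map (MvPolynomial.aeval x).toLinearMap

lemma mem_valueIdeal {n : σ → ℕ} {a : R} : a ∈ valueIdeal x deg n ↔
    ∃ p : MvPolynomial ι R, IsWeightedHomogeneous (multiWeight deg) p n ∧ MvPolynomial.aeval x p = a := Iff.rfl

lemma mul_mem_valueIdeal {m n : σ → ℕ} {a b : R} (ha : a ∈ valueIdeal x deg m)
    (hb : b ∈ valueIdeal x deg n) : a * b ∈ valueIdeal x deg (m + n) := by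
  obtain ⟨p, hp, rfl⟩ := mem_valueIdeal.mp ha
  obtain ⟨q, hq, rfl⟩ := mem_valueIdeal.mp hb
  exact mem_valueIdeal.mpr ⟨p * q, IsWeightedHomogeneous.mul hp hq, by simp⟩

lemma valueIdeal_mul_le (m n : σ → ℕ) :
    valueIdeal x deg m * valueIdeal x deg n ≤ valueIdeal x deg (m + n) :=
  Ideal.mul_le.mpr fun _ ha _ hb => mul_mem_valueIdeal ha hb

lemma valueIdeal_zero : valueIdeal x deg 0 = ⊤ := by
  rw [Ideal.eq_top_iff_one]
  exact mem_valueIdeal.mpr ⟨1, isWeightedHomogeneous_one _ _, by simp⟩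

variable [Fintype σ]

/-- The family `n ↦ (∏ⱼ Jⱼ ^ nⱼ) M`, where `Jⱼ` is generated by the `xᵢ` of degree `j`. -/
def reesFamily (x : ι → R) (deg : ι → σ) (M : Type*) [AddCommGroup M] [Module R M]
    (n : σ → ℕ) : Submodule R M :=
  (∏ j, degreeIdeal x deg j ^ n j) • ⊤

lemma prod_pow_add_single (J : σ → Ideal R) (n : σ → ℕ) (j : σ) :
    ∏ l, J l ^ (n + Pi.single j 1 : σ → ℕ) l = J j * ∏ l, J l ^ n l := by
  simp only [Pi.add_apply, pow_add, Finset.prod_mul_distrib]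
  rw [mul_comm, Finset.prod_eq_single_of_mem j (Finset.mem_univ j)
    (fun b _ hb => by simp [hb])]
  simp

lemma reesFamily_add_single (n : σ → ℕ) (j : σ) :
    reesFamily x deg M (n + Pi.single j 1) = degreeIdeal x deg j • reesFamily x deg M n := by
  rw [reesFamily, prod_pow_add_single, mul_smul, reesFamily]

lemma isStableFamily_reesFamily : IsStableFamily x deg (reesFamily x deg M) := by
  rintro i n _ ⟨v, hv, rfl⟩
  rw [reesFamily_add_single]
  exact Submodule.smul_mem_smul (Ideal.subset_span ⟨i, rfl, rfl⟩) hv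

lemma prod_degreeIdeal_pow_le (n : σ → ℕ) :
    ∏ j, degreeIdeal x deg j ^ n j ≤ valueIdeal x deg n := by
  have h1 : ∀ j, degreeIdeal x deg j ≤ valueIdeal x deg (Pi.single j 1) := by
    intro j
    refine Ideal.span_le.mpr ?_
    rintro _ ⟨i, rfl, rfl⟩
    exact mem_valueIdeal.mpr ⟨X i, isWeightedHomogeneous_X _ _ _, by simp⟩
  have h2 : ∀ j k, degreeIdeal x deg j ^ k ≤ valueIdeal x deg (Pi.single j k) := by
    intro j k
    induction k with
    | zero => simp [valueIdeal_zero]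
    | succ k ih =>
      rw [pow_succ, Pi.single_add]
      exact (Ideal.mul_mono ih (h1 j)).trans (valueIdeal_mul_le _ _)
  have h3 : ∀ s : Finset σ, ∏ j ∈ s, degreeIdeal x deg j ^ n j ≤
      valueIdeal x deg (∑ j ∈ s, Pi.single j (n j)) := by
    intro s
    induction s using Finset.induction_on with
    | empty => simp [valueIdeal_zero]
    | insert a s ha ih =>
      rw [Finset.prod_insert ha, Finset.sum_insert ha]
      exact (Ideal.mul_mono (h2 _ _) ih).trans (valueIdeal_mul_le _ _)
  simpa [Finset.univ_sum_single] using h3 Finset.univ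

/-- An element of `G n` lifts to a vector of polynomials homogeneous of multidegree `n`. Its other
components vanish, so membership of this lift in `toSubmodule` tests only `G n`. -/
lemma IsStableFamily.le_of_toSubmodule_le {G G' : (σ → ℕ) → Submodule R M}
    (hG : IsStableFamily x deg G) (hG' : IsStableFamily x deg G') (hle : G ≤ reesFamily x deg M)
    {k : ℕ} {g : Fin k → M} (hg : Submodule.span R (Set.range g) = ⊤)
    (h : hG.toSubmodule g ≤ hG'.toSubmodule g) : G ≤ G' := by
  classical
  intro n v hv
  have hv' := hle n hv
  rw [reesFamily, ← hg, Submodule.mem_ideal_smul_span_iff_exists_sum] at hv'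
  obtain ⟨a, ha, rfl⟩ := hv'
  rw [Finsupp.sum_fintype _ _ (by simp)] at hv ⊢
  choose p hp hpa using fun l => mem_valueIdeal.mp (prod_degreeIdeal_pow_le n (ha l))
  have hev : componentEval x deg g n p = ∑ l, a l • g l := by
    rw [componentEval_apply]
    refine Finset.sum_congr rfl fun l _ => ?_
    rw [IsWeightedHomogeneous.weightedHomogeneousComponent_same (hp l)]
    exact congrArg (· • g l) (hpa l)
  have hmem : p ∈ hG.toSubmodule g := by
    intro m
    by_cases hm : m = n
    · subst hm
      rwa [hev]
    · rw [componentEval_apply, Finset.sum_eq_zero]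
      · exact zero_mem _
      · intro l _
        rw [IsWeightedHomogeneous.weightedHomogeneousComponent_ne m (hp l) hm]
        simp
  rw [← hev]
  exact h hmem n

/-- Hilbert's basis theorem: chains of stable subfamilies become chains of submodules of a finite
free module over a polynomial ring. -/
lemma stableFamilyACC_reesFamily [Finite ι] [IsNoetherianRing R] [Module.Finite R M] :
    StableFamilyACC x deg (reesFamily x deg M) := by
  intro G hmono hs hle
  obtain ⟨k, g, hg⟩ := Module.Finite.exists_fin (R := R) (M := M)
  have hnoeth : IsNoetherian (MvPolynomial ι R) (Fin k → MvPolynomial ι R) := inferInstance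
  obtain ⟨c, hc⟩ := monotone_stabilizes_iff_noetherian.mpr hnoeth
    ⟨fun l => (hs l).toSubmodule g, fun l l' hl p hp n => hmono hl n (hp n)⟩
  refine ⟨c, fun l hl => le_antisymm ?_ (hmono hl)⟩
  exact (hs l).le_of_toSubmodule_le (hs c) (hle l) hg (hc l hl).ge

end ReesFamily

end StableFamilies

/-! ### Finite length and polynomiality for products of powers of ideals -/

section FiniteLength

variable {R : Type*} [CommRing R] {M : Type*} [AddCommGroup M] [Module R M]

lemma relLength_top (B : Submodule R M) : relLength ⊤ B = Module.length R (M ⧸ B) :=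
  (Submodule.Quotient.equiv _ _ (Submodule.topEquiv : (⊤ : Submodule R M) ≃ₗ[R] M)
    (by ext y; simp [Submodule.topEquiv])).length_eq

lemma length_quotient_eq_add {A B : Submodule R M} (h : B ≤ A) :
    Module.length R (M ⧸ B) = relLength A B + Module.length R (M ⧸ A) := by
  rw [← relLength_top, ← relLength_top, relLength_eq_add h le_top]

lemma relLength_smul (L : Ideal R) (A : Submodule R M) :
    relLength A (L • A) = Module.length R (A ⧸ (L • ⊤ : Submodule R A)) := by
  have : (L • A).comap A.subtype = (L • ⊤ : Submodule R A) := by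
    rw [← Submodule.comap_map_eq_of_injective A.injective_subtype (L • ⊤ : Submodule R A),
      Submodule.map_smul'', Submodule.map_top, Submodule.range_subtype]
  rw [relLength, this]

variable [IsLocalRing R]

open IsLocalRing

lemma maximalIdeal_le_radical_prod {σ : Type*} (s : Finset σ) {L : σ → Ideal R}
    (h : ∀ j ∈ s, maximalIdeal R ≤ (L j).radical) : maximalIdeal R ≤ (∏ j ∈ s, L j).radical := by
  refine Finset.prod_induction L (fun I => maximalIdeal R ≤ I.radical) ?_ ?_ h
  · intro I J hI hJ
    rw [Ideal.radical_mul]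
    exact le_inf hI hJ
  · rw [Ideal.one_eq_top, Ideal.radical_top]
    exact le_top

lemma maximalIdeal_le_radical_pow {L : Ideal R} (h : maximalIdeal R ≤ L.radical) (n : ℕ) :
    maximalIdeal R ≤ (L ^ n).radical := by
  simpa using maximalIdeal_le_radical_prod (Finset.range n) (L := fun _ => L) fun _ _ => h

lemma exists_supportDim_le (R M : Type*) [CommRing R] [IsLocalRing R] [IsNoetherianRing R]
    [AddCommGroup M] [Module R M] : ∃ d : ℕ, Module.supportDim R M ≤ d := by
  have h : Module.supportDim R M < ⊤ :=
    lt_of_le_of_lt (Module.supportDim_le_ringKrullDim R M) ringKrullDim_lt_top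
  induction hs : Module.supportDim R M with
  | bot => exact ⟨0, bot_le⟩
  | coe e =>
    rw [hs] at h
    lift e to ℕ using (WithBot.coe_lt_coe.mp h).ne
    exact ⟨e, le_rfl⟩

variable [IsNoetherianRing R] [Module.Finite R M]

lemma length_quotient_smul_top_ne_top {L : Ideal R} (hL : maximalIdeal R ≤ L.radical) :
    Module.length R (M ⧸ (L • ⊤ : Submodule R M)) ≠ ⊤ := by
  obtain ⟨d, hd⟩ := exists_supportDim_le R M
  obtain ⟨k, hk⟩ := Ideal.exists_pow_le_of_le_radical_of_fg hL (maximalIdeal R).fg_of_isNoetherianRing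
  obtain ⟨b, hb⟩ := exists_hilbertSamuel_le
    (Ideal.IsPrime.radical (maximalIdeal.isMaximal R).isPrime) d M hd
  refine ne_top_of_le_ne_top (ENat.natCast_ne_top _) ((length_quotient_le_of_le ?_).trans (hb k))
  exact Submodule.smul_mono_left hk

/-- The difference in direction `j` is the relative length of two consecutive members of the Rees
family, to which the Hilbert–Serre induction applies. -/
lemma isEventuallyPolynomial_length_quotient {σ : Type*} [Fintype σ] [DecidableEq σ]
    {J : σ → Ideal R} (hJ : ∀ j, maximalIdeal R ≤ (J j).radical) :
    IsEventuallyPolynomial fun n : σ → ℕ =>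
      ((Module.length R (M ⧸ ((∏ j, J j ^ n j) • ⊤ : Submodule R M))).toNat : ℚ) := by
  choose s hs using fun j => (J j).fg_of_isNoetherianRing
  -- Indexing by a sigma type keeps apart generators shared by several ideals.
  let x : (Σ j, s j) → R := fun i => i.2
  let deg : (Σ j, s j) → σ := Sigma.fst
  have hdeg : degreeIdeal x deg = J := by
    funext j
    rw [degreeIdeal, ← hs j]
    congr 1
    ext a
    constructor
    · rintro ⟨⟨j, a⟩, rfl, rfl⟩
      exact a.2
    · intro ha
      exact ⟨⟨j, a, ha⟩, rfl, rfl⟩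
  have hfin : ∀ n : σ → ℕ, Module.length R (M ⧸ reesFamily x deg M n) ≠ ⊤ := by
    intro n
    refine length_quotient_smul_top_ne_top (maximalIdeal_le_radical_prod _ fun j _ => ?_)
    rw [hdeg]
    exact maximalIdeal_le_radical_pow (hJ j) _
  have hle : ∀ (n : σ → ℕ) j, reesFamily x deg M (n + Pi.single j 1) ≤ reesFamily x deg M n := by
    intro n j
    rw [reesFamily_add_single]
    exact Submodule.smul_le_right
  have hmain : IsEventuallyPolynomial fun n : σ → ℕ =>
      ((Module.length R (M ⧸ reesFamily x deg M n)).toNat : ℚ) := by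
    refine IsEventuallyPolynomial.of_difference fun j => ?_
    have hstable : IsStableFamily x deg fun n => reesFamily x deg M (n + Pi.single j 1) := by
      intro i n
      beta_reduce
      rw [add_right_comm]
      exact isStableFamily_reesFamily i _
    have hrel : ∀ n, Module.length R (M ⧸ reesFamily x deg M (n + Pi.single j 1)) =
        relLength (reesFamily x deg M n) (reesFamily x deg M (n + Pi.single j 1)) +
          Module.length R (M ⧸ reesFamily x deg M n) := fun n => length_quotient_eq_add (hle n j)
    have hrfin : ∀ n, relLength (reesFamily x deg M n)
        (reesFamily x deg M (n + Pi.single j 1)) ≠ ⊤ := fun n =>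
      ne_top_of_le_ne_top (hfin _) (le_self_add.trans (hrel n).ge)
    convert isEventuallyPolynomial_relLength Finset.univ isStableFamily_reesFamily hstable
      (fun n => hle n j) stableFamilyACC_reesFamily hrfin (fun i hi => (hi (Finset.mem_univ i)).elim)
      using 2 with n
    rw [hrel, ENat.toNat_add (hrfin n) (hfin n)]
    push_cast
    ring
  rw [← hdeg]
  exact hmain

end FiniteLength

/-! ### Lengths along the filtrations -/

section FiltrationLength

variable {R : Type*} [CommRing R] {r : ℕ}

/-- The function `n ↦ λ(M / I(1)_{n₁} ⋯ I(r)_{nᵣ} M)`. -/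
noncomputable def filtrationLength (I : Fin r → IdealFiltration R) (M : Type*) [AddCommGroup M]
    [Module R M] (n : Fin r → ℕ) : ℕ∞ :=
  Module.length R (M ⧸ ((∏ j, (I j).ideal (n j)) • (⊤ : Submodule R M)))

variable {I : Fin r → IdealFiltration R} {M : Type*} [AddCommGroup M] [Module R M]

lemma filtrationLength_mono : Monotone (filtrationLength I M) := fun _ _ h =>
  length_quotient_le_of_le (Submodule.smul_mono_left
    (Finset.prod_le_prod' fun j _ => (I j).antitone (h j)))

variable [IsLocalRing R]

open IsLocalRing

lemma IdealFiltration.IsMaximalPrimary.maximalIdeal_le_radical {I : IdealFiltration R}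
    (h : I.IsMaximalPrimary) (n : ℕ) : maximalIdeal R ≤ (I.ideal n).radical := by
  rcases Nat.eq_zero_or_pos n with rfl | hn
  · rw [I.ideal_zero, Ideal.radical_top]
    exact le_top
  · exact (h n hn).2.ge

lemma radical_prod_ideal (hr : 1 ≤ r) (hI : ∀ j, (I j).IsMaximalPrimary) {α : ℕ} (hα : 0 < α) :
    (∏ j, (I j).ideal α).radical = maximalIdeal R := by
  refine le_antisymm ?_ (maximalIdeal_le_radical_prod _ fun j _ =>
    (hI j).maximalIdeal_le_radical α)
  -- An empty product would be the unit ideal, so a factor is needed here.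
  rw [← ((hI ⟨0, hr⟩) α hα).2]
  exact Ideal.radical_mono (Ideal.prod_le_inf.trans (Finset.inf_le (Finset.mem_univ _)))

variable [IsNoetherianRing R] [Module.Finite R M]

lemma filtrationLength_ne_top (hI : ∀ j, (I j).IsMaximalPrimary) (n : Fin r → ℕ) :
    filtrationLength I M n ≠ ⊤ :=
  length_quotient_smul_top_ne_top
    (maximalIdeal_le_radical_prod _ fun j _ => (hI j).maximalIdeal_le_radical _)

/-- By periodicity the submodule at `b + α t` is `∏ I(j)_α ^ t_j K` with `K` fixed, so the length is
a constant plus a length for powers of ideals acting on `K`. -/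
lemma isEventuallyPolynomial_filtrationLength (hI : ∀ j, (I j).IsMaximalPrimary) {α c : ℕ}
    (hα : ∀ j, (I j).IsPeriodFrom α c) (b : Fin r → ℕ) (hb : ∀ j, c ≤ b j) :
    IsEventuallyPolynomial fun t => ((filtrationLength I M (b + α • t)).toNat : ℚ) := by
  set K : Submodule R M := (∏ j, (I j).ideal (b j)) • ⊤ with hK
  have hprod : ∀ t : Fin r → ℕ, (∏ j, (I j).ideal ((b + α • t) j)) • (⊤ : Submodule R M) =
      (∏ j, (I j).ideal α ^ t j) • K := by
    intro t
    rw [hK, ← mul_smul, ← Finset.prod_mul_distrib]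
    congr 1
    exact Finset.prod_congr rfl fun j _ => (hα j).ideal_add_mul (hb j) (t j)
  have hrad : ∀ j, maximalIdeal R ≤ ((I j).ideal α).radical := fun j =>
    (hI j).maximalIdeal_le_radical α
  have hlen : ∀ t : Fin r → ℕ, filtrationLength I M (b + α • t) =
      Module.length R (K ⧸ ((∏ j, (I j).ideal α ^ t j) • ⊤ : Submodule R K)) +
        filtrationLength I M b := by
    intro t
    rw [filtrationLength, hprod, length_quotient_eq_add Submodule.smul_le_right, relLength_smul]
    rfl
  obtain ⟨c', Q, hQ⟩ := isEventuallyPolynomial_length_quotient (M := K) hrad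
  refine ⟨c', Q + MvPolynomial.C ((filtrationLength I M b).toNat : ℚ), fun n hn => ?_⟩
  beta_reduce at hQ ⊢
  rw [hlen, ENat.toNat_add, Nat.cast_add, hQ n hn, map_add, MvPolynomial.eval_C]
  · refine ne_top_of_le_ne_top (filtrationLength_ne_top (M := M) hI (b + α • n)) ?_
    rw [hlen]
    exact le_self_add
  · exact filtrationLength_ne_top hI b

/-- Since `I_α ^ t ≤ I_{α t} ≤ I_t`, the diagonal is bounded by the Hilbert–Samuel function of `∏
I(j)_α`. -/
lemma exists_filtrationLength_const_le (hr : 1 ≤ r) (hI : ∀ j, (I j).IsMaximalPrimary) {α : ℕ}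
    (hα : 0 < α) {d : ℕ} (hd : Module.supportDim R M ≤ d) :
    ∃ b : ℕ, ∀ t : ℕ, (filtrationLength I M fun _ => t).toNat ≤ b * (t + 1) ^ d := by
  obtain ⟨b, hb⟩ := exists_hilbertSamuel_le (radical_prod_ideal hr hI hα) d M hd
  refine ⟨b, fun t => ENat.toNat_le_of_le_natCast (le_trans ?_ (hb t))⟩
  refine length_quotient_le_of_le (Submodule.smul_mono_left ?_)
  rw [← Finset.prod_pow]
  refine Finset.prod_le_prod' fun j _ => ?_
  have h1 := (I j).prod_pow_le {α} fun _ => t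
  rw [Finset.prod_singleton, Finset.sum_singleton] at h1
  exact h1.trans ((I j).antitone (Nat.le_mul_of_pos_left t hα))

/-- Conversely `I_{c + α s} = I_α ^ s * I_c ≤ I_α ^ s`, by periodicity. -/
lemma exists_choose_le_filtrationLength_const (hr : 1 ≤ r) (hI : ∀ j, (I j).IsMaximalPrimary)
    {α c : ℕ} (hα : 0 < α) (hc : ∀ j, (I j).IsPeriodFrom α c) {d : ℕ}
    (hd : d ≤ Module.supportDim R M) :
    ∃ a K : ℕ, 0 < K ∧ ∀ t : ℕ, t.choose d ≤ (filtrationLength I M fun _ => a + K * t).toNat := by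
  obtain ⟨a, K, h⟩ := exists_choose_supportDim_le_hilbertSamuel
    (Ideal.le_radical.trans (radical_prod_ideal hr hI hα).le) d hd
  -- The extra `1` makes the stride positive even if `K = 0`.
  refine ⟨c + α * a, α * K + 1, Nat.succ_pos _, fun t => ?_⟩
  have h1 : (t.choose d : ℕ∞) ≤ filtrationLength I M fun _ => c + α * (a + K * t) := by
    refine (h t).trans (length_quotient_le_of_le (Submodule.smul_mono_left ?_))
    rw [← Finset.prod_pow]
    refine Finset.prod_le_prod' fun j _ => ?_
    rw [(hc j).ideal_add_mul le_rfl]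
    exact Ideal.mul_le_left.trans_eq' rfl
  have h2 := h1.trans (filtrationLength_mono
    (b := fun _ => c + α * a + (α * K + 1) * t) fun _ => by beta_reduce; nlinarith)
  rw [← ENat.natCast_toNat (filtrationLength_ne_top hI _)] at h2
  exact_mod_cast h2

end FiltrationLength

/-! ### Degrees and leading forms across residue classes -/

section QuasiPolynomialFunctions

open MvPolynomial Filter Topology

variable {σ : Type*}

lemma MvPolynomial.homogeneousComponent_totalDegree_ne_zero {P : MvPolynomial σ ℚ} (hP : P ≠ 0) :
    homogeneousComponent P.totalDegree P ≠ 0 := by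
  obtain ⟨m, hm, hmd⟩ := Finset.exists_mem_eq_sup P.support (support_nonempty.mpr hP)
    fun s => s.sum fun _ e => e
  intro h0
  have h1 := congrArg (coeff m) h0
  rw [coeff_homogeneousComponent, if_pos, MvPolynomial.coeff_zero] at h1
  · exact mem_support_iff.mp hm h1
  · exact hmd.symm

variable {h : (σ → ℕ) → ℕ} {α C B d : ℕ} {P : (σ → ℕ) → MvPolynomial σ ℚ}

/-- Steps by multiples of `α` stay in the class of `u`. The base point may be any representative of
that class, not only the reduced one. -/
lemma eval_residue_eq (hP : ∀ n : σ → ℕ, (∀ j, C ≤ n j) →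
      (h n : ℚ) = eval (fun j => (n j : ℚ)) (P fun j => n j % α)) (hα : 0 < α)
    {b u m : σ → ℕ} (hb : ∀ j, u j % α = b j) (hm : ∀ j, 1 ≤ m j) {s : ℕ} (hs : C ≤ s) :
    eval (fun j => (u j : ℚ) + s * (α * m j)) (P b) = h (fun j => u j + s * (α * m j)) := by
  rw [hP]
  · have : (fun j => (u j + s * (α * m j)) % α) = b := by
      funext j
      rw [show s * (α * m j) = α * (s * m j) by ring, Nat.add_mul_mod_self_left, hb]
    rw [this]
    push_cast
    rfl
  · intro j
    calc C ≤ s * 1 := by omega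
      _ ≤ s * (α * m j) := Nat.mul_le_mul_left _ (Nat.mul_pos hα (hm j))
      _ ≤ _ := Nat.le_add_left _ _

lemma MvPolynomial.eq_of_eval_multiples_eq {P Q : MvPolynomial σ ℚ} (hα : 0 < α)
    (h : ∀ m : σ → ℕ, (∀ j, 1 ≤ m j) →
      eval (fun j => (α * m j : ℚ)) P = eval (fun j => (α * m j : ℚ)) Q) : P = Q := by
  have hinf : Set.Infinite (Set.range fun k : ℕ => (α * (k + 1 : ℕ) : ℚ)) := by
    refine Set.infinite_range_of_injective fun k l hkl => ?_
    have hα' : (α : ℚ) ≠ 0 := by positivity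
    simpa [hα'] using hkl
  refine funext_set (fun _ => Set.range fun k : ℕ => (α * (k + 1 : ℕ) : ℚ)) (fun _ => hinf)
    fun x hx => ?_
  choose k hk using fun j => hx j (Set.mem_univ j)
  have := h (fun j => k j + 1) fun j => Nat.le_add_left _ _
  rwa [show (fun j => (α * (k j + 1 : ℕ) : ℚ)) = x from _root_.funext hk] at this

variable [Fintype σ]

lemma exists_mvPolynomial_of_residues {h : (σ → ℕ) → ℚ} {c : ℕ} (hα : 0 < α)
    (hpoly : ∀ b : σ → ℕ, (∀ j, c ≤ b j) → IsEventuallyPolynomial fun t => h (b + α • t)) :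
    ∃ (C : ℕ) (P : (σ → ℕ) → MvPolynomial σ ℚ), ∀ n : σ → ℕ, (∀ j, C ≤ n j) →
      h n = eval (fun j => (n j : ℚ)) (P fun j => n j % α) := by
  classical
  let rep : (σ → ℕ) → σ → ℕ := fun b j => α * c + b j
  have hrep : ∀ b j, c ≤ rep b j := fun b j =>
    (Nat.le_mul_of_pos_left c hα).trans (Nat.le_add_right _ _)
  choose C Q hQ using fun b => hpoly (rep b) (hrep b)
  let E : ℕ := (Fintype.piFinset fun _ : σ => Finset.range α).sup C
  -- Each class is started at `α c + b`, beyond `c`; the substitution is `t = (n - rep b) / α`, and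
  -- `E` bounds the thresholds of the finitely many classes.
  refine ⟨α * (c + E), fun b => bind₁ (fun j =>
    MvPolynomial.C ((α : ℚ)⁻¹) * (X j - MvPolynomial.C (rep b j : ℚ))) (Q b), fun n hn => ?_⟩
  set b : σ → ℕ := fun j => n j % α with hb
  have hdiv : ∀ j, c + E ≤ n j / α := fun j =>
    (Nat.le_div_iff_mul_le hα).mpr (by rw [mul_comm]; exact hn j)
  have hCE : C b ≤ E := Finset.le_sup (f := C) (Fintype.mem_piFinset.mpr fun j =>
    Finset.mem_range.mpr (Nat.mod_lt _ hα))
  let t : σ → ℕ := fun j => n j / α - c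
  have hnt : n = rep b + α • t := by
    funext j
    change n j = α * c + n j % α + α * (n j / α - c)
    have h1 := Nat.div_add_mod (n j) α
    have h2 : α * (n j / α) = α * c + α * (n j / α - c) := by
      rw [← mul_add, Nat.add_sub_cancel' (by have := hdiv j; omega)]
    omega
  have hval : h n = eval (fun j => (t j : ℚ)) (Q b) := by
    conv_lhs => rw [hnt]
    exact hQ b t fun j => by have := hdiv j; change C b ≤ n j / α - c; omega
  rw [hval, eval_bind₁]
  congr 2
  funext j
  have h3 : (n j : ℚ) = rep b j + α * t j := by
    conv_lhs => rw [hnt]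
    simp
  have hα' : (α : ℚ) ≠ 0 := by positivity
  rw [map_mul, map_sub, MvPolynomial.eval_C, MvPolynomial.eval_C, MvPolynomial.eval_X, h3]
  field_simp
  ring

/-- Monotonicity extends the diagonal bound to every direction. If the degree `D` exceeded `d`,
dividing by `s^D` would send the values to zero, so the leading form would vanish. -/
lemma totalDegree_residue_le (hP : ∀ n : σ → ℕ, (∀ j, C ≤ n j) →
      (h n : ℚ) = eval (fun j => (n j : ℚ)) (P fun j => n j % α)) (hα : 0 < α) (hmono : Monotone h)
    (hB : ∀ t : ℕ, h (fun _ => t) ≤ B * (t + 1) ^ d) {b : σ → ℕ} (hb : ∀ j, b j < α) :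
    (P b).totalDegree ≤ d := by
  by_contra! hlt
  have hne : P b ≠ 0 := by
    intro h0
    rw [h0, totalDegree_zero] at hlt
    omega
  refine homogeneousComponent_totalDegree_ne_zero hne (eq_of_eval_multiples_eq hα fun m hm => ?_)
  rw [map_zero]
  refine tendsto_nhds_unique (tendsto_eval_div_pow le_rfl (fun j => (b j : ℚ)) _) ?_
  -- Chosen so that `α + s α ∑ m + 1 ≤ E s` for `s ≥ 1`.
  set E : ℕ := α + α * ∑ j, m j + 1
  have hlim : Tendsto (fun s : ℕ => ((B * E ^ d : ℕ) : ℚ) * ((s : ℚ))⁻¹) atTop (𝓝 0) := by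
    have : Tendsto (fun s : ℕ => ((s : ℚ))⁻¹) atTop (𝓝 0) :=
      tendsto_inv_atTop_zero.comp tendsto_natCast_atTop_atTop
    simpa using this.const_mul ((B * E ^ d : ℕ) : ℚ)
  refine tendsto_of_tendsto_of_tendsto_of_le_of_le' tendsto_const_nhds hlim ?_ ?_
  · filter_upwards [eventually_ge_atTop C] with s hs
    rw [eval_residue_eq hP hα (fun j => Nat.mod_eq_of_lt (hb j)) hm hs]
    positivity
  · filter_upwards [eventually_ge_atTop C, eventually_ge_atTop 1] with s hs hs1
    rw [eval_residue_eq hP hα (fun j => Nat.mod_eq_of_lt (hb j)) hm hs]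
    have hs0 : (0 : ℚ) < s := by exact_mod_cast hs1
    have h1 : h (fun j => b j + s * (α * m j)) ≤ B * E ^ d * s ^ d := by
      refine (hmono (show _ ≤ fun _ => α + s * (α * ∑ j, m j) from fun j => ?_)).trans
        ((hB _).trans ?_)
      · beta_reduce
        gcongr
        · exact (hb j).le
        · exact Finset.single_le_sum (fun _ _ => Nat.zero_le _) (Finset.mem_univ j)
      · rw [mul_assoc, ← mul_pow]
        gcongr
        simp only [E]
        nlinarith
    rw [div_le_iff₀ (by positivity)]
    calc (h (fun j => b j + s * (α * m j)) : ℚ) ≤ ((B * E ^ d * s ^ d : ℕ) : ℚ) := by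
          exact_mod_cast h1
      _ ≤ (B * E ^ d : ℕ) * ((s : ℚ) ^ ((P b).totalDegree - 1)) := by
          push_cast
          gcongr
          · exact_mod_cast hs1
          · omega
      _ = _ := by
          rw [mul_assoc]
          congr 1
          obtain ⟨k, hk⟩ : ∃ k, (P b).totalDegree = k + 1 := ⟨_, (Nat.sub_add_cancel (by omega)).symm⟩
          rw [hk, Nat.add_sub_cancel, pow_succ]
          field_simp

/-- For `0 ≤ b ≤ α`, monotonicity puts the value along `b + s α m` between those along `s α m` and
`α + s α m`. Both outer lines lie in the class 0, and their limits coincide. -/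
lemma homogeneousComponent_residue_eq (hP : ∀ n : σ → ℕ, (∀ j, C ≤ n j) →
      (h n : ℚ) = eval (fun j => (n j : ℚ)) (P fun j => n j % α)) (hα : 0 < α) (hmono : Monotone h)
    (hB : ∀ t : ℕ, h (fun _ => t) ≤ B * (t + 1) ^ d) {b : σ → ℕ} (hb : ∀ j, b j < α) :
    homogeneousComponent d (P b) = homogeneousComponent d (P 0) := by
  have hdb := totalDegree_residue_le hP hα hmono hB hb
  have hd0 := totalDegree_residue_le hP hα hmono hB (b := 0) fun _ => hα
  refine eq_of_eval_multiples_eq hα fun m hm => le_antisymm ?_ ?_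
  · refine le_of_tendsto_of_tendsto (tendsto_eval_div_pow hdb (fun j => (b j : ℚ)) _)
      (tendsto_eval_div_pow hd0 (fun _ => ((α : ℕ) : ℚ)) _) ?_
    filter_upwards [eventually_ge_atTop C] with s hs
    rw [eval_residue_eq hP hα (fun j => Nat.mod_eq_of_lt (hb j)) hm hs,
      eval_residue_eq hP hα (b := 0) (u := fun _ => α) (fun j => Nat.mod_self α) hm hs]
    gcongr
    exact hmono fun j => Nat.add_le_add_right (hb j).le _
  · refine le_of_tendsto_of_tendsto (tendsto_eval_div_pow hd0 (fun _ => ((0 : ℕ) : ℚ)) _)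
      (tendsto_eval_div_pow hdb (fun j => (b j : ℚ)) _) ?_
    filter_upwards [eventually_ge_atTop C] with s hs
    rw [eval_residue_eq hP hα (fun j => Nat.mod_eq_of_lt (hb j)) hm hs,
      eval_residue_eq hP hα (b := 0) (u := fun _ => 0) (fun j => Nat.zero_mod α) hm hs]
    gcongr
    exact hmono fun j => Nat.add_le_add_right (Nat.zero_le _) _

/-- For `t ≥ 2 d`, `t.choose d ≥ (t + 1 - d)^d / d! ≥ (t/2)^d / d!`, so the limit along a diagonal
line of class 0 is at least `1 / (2^d d!)`. -/
lemma homogeneousComponent_zero_ne_zero (hP : ∀ n : σ → ℕ, (∀ j, C ≤ n j) →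
      (h n : ℚ) = eval (fun j => (n j : ℚ)) (P fun j => n j % α)) (hα : 0 < α) (hmono : Monotone h)
    (hB : ∀ t : ℕ, h (fun _ => t) ≤ B * (t + 1) ^ d) {a K : ℕ} (hK : 0 < K)
    (hlow : ∀ t : ℕ, t.choose d ≤ h fun _ => a + K * t) :
    homogeneousComponent d (P 0) ≠ 0 := by
  have hd0 := totalDegree_residue_le hP hα hmono hB (b := 0) fun _ => hα
  intro h0
  have hlim := tendsto_eval_div_pow hd0 (fun _ => ((α * a : ℕ) : ℚ))
    (fun _ => (α * (K : ℕ) : ℚ))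
  rw [h0, map_zero] at hlim
  have hpos : (0 : ℚ) < 1 / (2 ^ d * d.factorial) := by positivity
  refine absurd (ge_of_tendsto hlim ?_) (not_le.mpr hpos)
  filter_upwards [eventually_ge_atTop C, eventually_ge_atTop (2 * d), eventually_ge_atTop 1]
    with t htC htd ht1
  rw [eval_residue_eq hP hα (b := 0) (u := fun _ => α * a) (m := fun _ => K)
    (fun j => Nat.mul_mod_right α a) (fun _ => hK) htC]
  have ht0 : (0 : ℚ) < t := by exact_mod_cast ht1
  have h1 : t.choose d ≤ h fun _ => α * a + t * (α * K) := by
    refine (hlow t).trans (hmono fun _ => ?_)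
    beta_reduce
    calc a + K * t ≤ α * (a + K * t) := Nat.le_mul_of_pos_left _ hα
      _ = _ := by ring
  have h2 : (((t + 1 - d : ℕ) : ℚ) ^ d) / (d.factorial : ℚ) ≤ t.choose d := by
    exact_mod_cast Nat.pow_le_choose (α := ℚ) d t
  have h3 : (t : ℚ) / 2 ≤ ((t + 1 - d : ℕ) : ℚ) := by
    rw [div_le_iff₀ two_pos]
    exact_mod_cast (by omega : t ≤ (t + 1 - d) * 2)
  rw [le_div_iff₀ (by positivity)]
  calc 1 / (2 ^ d * (d.factorial : ℚ)) * (t : ℚ) ^ d = ((t : ℚ) / 2) ^ d / d.factorial := by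
        rw [div_pow]
        field_simp
    _ ≤ (((t + 1 - d : ℕ) : ℚ) ^ d) / (d.factorial : ℚ) := by gcongr
    _ ≤ t.choose d := h2
    _ ≤ _ := by exact_mod_cast h1

end QuasiPolynomialFunctions

/-! ### Quasi-polynomials from residue classes, and the theorem -/

namespace QuasiPolynomial

variable {r : ℕ}

/-- The quasi-polynomial given by the polynomial `P b` on the arguments congruent to `b`
modulo `α`. -/
noncomputable def ofResidues {α : ℕ} (hα : 0 < α) (P : (Fin r → ℕ) → MvPolynomial (Fin r) ℚ) :
    QuasiPolynomial r where
  coeff := Finsupp.onFinset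
    ((Fintype.piFinset fun _ : Fin r => Finset.range α).biUnion fun b => (P b).support)
    (fun i n => (P fun j => n j % α).coeff i) (by
      intro i hi
      obtain ⟨n, hn⟩ := Function.ne_iff.mp hi
      exact Finset.mem_biUnion.mpr ⟨_, Fintype.mem_piFinset.mpr fun j =>
        Finset.mem_range.mpr (Nat.mod_lt _ hα), MvPolynomial.mem_support_iff.mpr hn⟩)
  periodic := by
    refine fun i => ⟨α, hα, fun n j => ?_⟩
    rw [Finsupp.onFinset_apply]
    congr 2
    funext l
    by_cases hl : l = j
    · subst hl; simp
    · simp [hl]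

variable {α : ℕ} (hα : 0 < α) (P : (Fin r → ℕ) → MvPolynomial (Fin r) ℚ)

lemma coeff_ofResidues (i : Fin r →₀ ℕ) (n : Fin r → ℕ) :
    (ofResidues hα P).coeff i n = (P fun j => n j % α).coeff i := rfl

lemma mem_support_ofResidues {i : Fin r →₀ ℕ} :
    i ∈ (ofResidues hα P).coeff.support ↔
      ∃ n : Fin r → ℕ, (P fun j => n j % α).coeff i ≠ 0 := by
  rw [Finsupp.mem_support_iff]
  exact Function.ne_iff

lemma eval_ofResidues (n : Fin r → ℕ) :
    (ofResidues hα P).eval n =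
      MvPolynomial.eval (fun j => (n j : ℚ)) (P fun j => n j % α) := by
  rw [MvPolynomial.eval_eq', eval]
  symm
  refine Finset.sum_subset (fun i hi => ?_) fun i _ hi => ?_
  · exact (mem_support_ofResidues hα P).mpr ⟨n, MvPolynomial.mem_support_iff.mp hi⟩
  · rw [MvPolynomial.notMem_support_iff.mp hi, zero_mul]

end QuasiPolynomial

namespace QuasiPolynomial

variable {r : ℕ} {α : ℕ} (hα : 0 < α) {P : (Fin r → ℕ) → MvPolynomial (Fin r) ℚ} {d : ℕ}

lemma totalDegree_ofResidues (hP : ∀ b, (∀ j, b j < α) → (P b).totalDegree ≤ d)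
    (h0 : MvPolynomial.homogeneousComponent d (P 0) ≠ 0) :
    (ofResidues hα P).totalDegree = (d : WithBot ℕ∞) := by
  refine le_antisymm (Finset.sup_le fun i hi => ?_) ?_
  · obtain ⟨n, hn⟩ := (mem_support_ofResidues hα P).mp hi
    have h1 := (MvPolynomial.le_totalDegree (MvPolynomial.mem_support_iff.mpr hn)).trans
      (hP _ fun j => Nat.mod_lt _ hα)
    rw [Finsupp.sum_fintype _ _ fun _ => rfl] at h1
    exact_mod_cast h1
  · obtain ⟨i, hi⟩ := MvPolynomial.ne_zero_iff.mp h0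
    rw [MvPolynomial.coeff_homogeneousComponent, ite_ne_right_iff] at hi
    have hmem : i ∈ (ofResidues hα P).coeff.support :=
      (mem_support_ofResidues hα P).mpr ⟨0, by
        simp only [Pi.zero_apply, Nat.zero_mod]
        exact hi.2⟩
    have h2 := Finset.le_sup (f := fun i : Fin r →₀ ℕ => ((∑ j, i j : ℕ) : WithBot ℕ∞)) hmem
    rwa [← Finsupp.degree_eq_sum, hi.1] at h2

lemma coeff_ofResidues_eq (hP : ∀ b, (∀ j, b j < α) →
      MvPolynomial.homogeneousComponent d (P b) = MvPolynomial.homogeneousComponent d (P 0))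
    {i : Fin r →₀ ℕ} (hi : ∑ j, i j = d) (n : Fin r → ℕ) :
    (ofResidues hα P).coeff i n = (P 0).coeff i := by
  have h1 := congrArg (MvPolynomial.coeff i) (hP (fun j => n j % α) fun j => Nat.mod_lt _ hα)
  rwa [MvPolynomial.coeff_homogeneousComponent, MvPolynomial.coeff_homogeneousComponent,
    Finsupp.degree_eq_sum, if_pos hi, if_pos hi] at h1

end QuasiPolynomial

theorem proposition3 {R : Type u} [CommRing R] [IsLocalRing R] [IsNoetherianRing R]
    {M : Type v} [AddCommGroup M] [Module R M] [Module.Finite R M]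
    (r : ℕ) (hr : 1 ≤ r) (I : Fin r → IdealFiltration R)
    (hprimary : ∀ j, (I j).IsMaximalPrimary) (hnoeth : ∀ j, (I j).IsNoetherian) :
    ∃ (c : ℕ) (P : QuasiPolynomial r), 0 < c ∧
      (∀ n : Fin r → ℕ, (∀ j, c ≤ n j) →
        ∃ l : ℕ,
          Module.length R
            (M ⧸ ((∏ j, (I j).ideal (n j)) • (⊤ : Submodule R M))) = (l : ℕ∞) ∧
          (l : ℚ) = P.eval n) ∧
      P.totalDegree = Module.supportDim R M ∧
      (∀ i : Fin r →₀ ℕ,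
        ((∑ j, i j : ℕ) : WithBot ℕ∞) = Module.supportDim R M →
          ∃ q : ℚ, ∀ n : Fin r → ℕ, P.coeff i n = q) := by
  rcases subsingleton_or_nontrivial M with hM | hM
  · rw [Module.supportDim_eq_bot_of_subsingleton]
    -- For `M = 0` the zero quasi-polynomial has total degree `⊥`, as does the dimension.
    refine ⟨1, ⟨0, fun i => ⟨1, one_pos, fun n j => rfl⟩⟩, one_pos, fun n _ => ⟨0, ?_, ?_⟩, ?_,
      fun i hi => ⟨0, fun n => rfl⟩⟩
    · exact Module.length_eq_zero
    · simp [QuasiPolynomial.eval]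
    · simp [QuasiPolynomial.totalDegree]
  · obtain ⟨d, hd⟩ : ∃ d : ℕ, Module.supportDim R M = d := by
      obtain ⟨e, he⟩ := exists_supportDim_le R M
      obtain ⟨s, hs⟩ := WithBot.ne_bot_iff_exists.mp (Module.supportDim_ne_bot_of_nontrivial R M)
      rw [← hs] at he ⊢
      lift s to ℕ using ne_top_of_le_ne_top (ENat.natCast_ne_top e) (WithBot.coe_le_coe.mp he)
      exact ⟨s, rfl⟩
    obtain ⟨α, c, hα, hper⟩ := IdealFiltration.exists_common_isPeriodFrom I hnoeth
    have hfin := filtrationLength_ne_top (M := M) hprimary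
    let h : (Fin r → ℕ) → ℕ := fun n => (filtrationLength I M n).toNat
    have hmono : Monotone h := fun n n' hn =>
      ENat.toNat_le_toNat (filtrationLength_mono hn) (hfin n')
    obtain ⟨C, P, hP⟩ := exists_mvPolynomial_of_residues (h := fun n => (h n : ℚ)) hα
      (isEventuallyPolynomial_filtrationLength hprimary hper)
    obtain ⟨B, hB⟩ := exists_filtrationLength_const_le (M := M) hr hprimary hα hd.le
    obtain ⟨a, K, hK, hlow⟩ := exists_choose_le_filtrationLength_const hr hprimary hα hper hd.ge
    -- The threshold is `C + 1` only to be positive.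
    refine ⟨C + 1, QuasiPolynomial.ofResidues hα P, Nat.succ_pos C, fun n hn => ⟨h n, ?_, ?_⟩, ?_,
      fun i hi => ⟨(P 0).coeff i, fun n => QuasiPolynomial.coeff_ofResidues_eq hα (P := P) (d := d)
        (fun b hb => homogeneousComponent_residue_eq hP hα hmono hB hb) ?_ n⟩⟩
    · exact (ENat.natCast_toNat (hfin n)).symm
    · rw [QuasiPolynomial.eval_ofResidues]
      exact hP n fun j => (Nat.le_succ C).trans (hn j)
    · rw [hd]
      exact QuasiPolynomial.totalDegree_ofResidues hα
        (fun b hb => totalDegree_residue_le hP hα hmono hB hb)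
        (homogeneousComponent_zero_ne_zero hP hα hmono hB hK hlow)
    · rw [hd] at hi
      exact_mod_cast hi
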